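/- Let $K$ be an algebraically closed field of characteristic $0$ and let $X=\nu_3(G_{3,7})\subset\mathbb P(\wedge^3K^7)=\mathbb P^{34}$ be the Grassmannian of $3$-dimensional subspaces of $K^7$ in its Plücker embedding, so that $\dim X=12$. Let $X^3$ be the variety of secant planes of $X$, i.e. the Zariski closure of the union of all linear spaces spanned by three points of $X$. Its expected dimension is $\min\{34,\,3\cdot 12+2\}=34$. Then $X^3\neq\mathbb P^{34}$; more precisely $\dim X^3=33$, so $X^3$ is defective, with defect (expected dimension minus dimension) equal to $1$. Moreover, for every basis $e_0,\dots,e_6$ of $K^7$ and vectors $v,w\in K^7$ put $$Z=\bigl[(e_0,e_1,e_2)^2\cap(e_3,e_4,e_5)^2\cap(e_6,v,w)^2\bigr]_4,$$ the degree $4$ part of the intersection of the squares of the indicated two-sided ideals of the exterior algebra $\bigwedge(K^7)$. Then $\dim_KZ=1$ for generic $v,w$ (that is, for all $(v,w)$ in some nonempty Zariski open subset of $K^7\times K^7$). If $v=e_0+\cdots+e_5$ and $w=\sum_{i=0}^5b_ie_i$, then a vector $v\wedge w\wedge\Gamma$ with $$\Gamma=c_0\,e_1\wedge e_2+c_1\,e_1\wedge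 e_3+c_2\,e_1\wedge e_4+c_3\,e_2\wedge e_3+c_4\,e_2\wedge e_4+c_5\,e_3\wedge e_4$$ lies in $Z$ if and only if $c=(c_0,\dots,c_5)^{T}$ satisfies $Mc=0$, where $$M=\begin{pmatrix} b_3-b_0&b_0-b_2&0&b_1-b_0&0&0\\ b_4-b_0&0&b_0-b_2&0&b_1-b_0&0\\ b_5-b_0&0&0&0&0&0\\ 0&0&0&0&0&b_5-b_0\\ 0&b_5-b_4&b_3-b_5&0&0&b_5-b_1\\ 0&0&0&b_5-b_4&b_3-b_5&b_5-b_2\end{pmatrix};$$ for generic $b_0,\dots,b_5\in K$ the matrix $M$ has rank $5$ and $\dim_KZ=1$. -/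

import Mathlib

open scoped LinearAlgebra.Projectivization

noncomputable section

namespace SecantGrassmann

/-! ### Projective varieties in `ℙ(M)`, with homogeneous coordinates given by a basis of `M` -/

section Projective

variable {K M ι : Type*} [Field K] [AddCommGroup M] [Module K M] [Finite ι]

/-- The affine cone over a set of points of `ℙ(M)`, in the coordinates of the basis `b`. -/
def affineCone (b : Module.Basis ι K M) (S : Set (ℙ K M)) : Set (ι → K) :=
  {y | ∃ p ∈ S, ∃ x ∈ p.submodule, y = b.equivFun x}

/-- The ideal of all polynomials in the coordinates that vanish on the cone over `S`.  Over an
infinite field this is the homogeneous ideal of `S`. -/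
def homogeneousIdeal (b : Module.Basis ι K M) (S : Set (ℙ K M)) : Ideal (MvPolynomial ι K) :=
  MvPolynomial.vanishingIdeal K (affineCone b S)

/-- The Zariski closure of `S` in `ℙ(M)`: the points at which every form vanishing on `S`
vanishes. -/
def zariskiClosure (b : Module.Basis ι K M) (S : Set (ℙ K M)) : Set (ℙ K M) :=
  {p | ∀ x ∈ p.submodule, b.equivFun x ∈ MvPolynomial.zeroLocus K (homogeneousIdeal b S)}

/-- `S` has dimension `d` as a projective variety: its homogeneous coordinate ring has Krull
dimension `d + 1`. -/
def HasProjDim (b : Module.Basis ι K M) (S : Set (ℙ K M)) (d : ℕ) : Prop :=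
  ringKrullDim (MvPolynomial ι K ⧸ homogeneousIdeal b S) = ((d + 1 : ℕ) : WithBot ℕ∞)

/-- The `s`-th secant variety of `X`: the Zariski closure of the union of all linear spaces
spanned by `s` points of `X`. -/
def secantVariety (b : Module.Basis ι K M) (X : Set (ℙ K M)) (s : ℕ) : Set (ℙ K M) :=
  zariskiClosure b
    {p | ∃ P : Fin s → ℙ K M, (∀ i, P i ∈ X) ∧ p.submodule ≤ ⨆ i, (P i).submodule}

/-- The expected dimension `min {N, s n + (s - 1)}` of the `s`-th secant variety of an
`n`-dimensional variety in `ℙ^N`. -/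
def expectedDim (N n s : ℕ) : ℕ := min N (s * n + (s - 1))

/-- The `s`-th secant variety of `X ⊆ ℙ(M)` has dimension smaller than the expected one. -/
def IsDefective (b : Module.Basis ι K M) (X : Set (ℙ K M)) (s : ℕ) : Prop :=
  ∃ n d : ℕ, HasProjDim b X n ∧ HasProjDim b (secantVariety b X s) d ∧
    d < expectedDim (Module.finrank K M - 1) n s

/-- The `s`-th secant variety of `X ⊆ ℙ(M)` has defect (expected minus actual dimension) `δ`. -/
def HasDefect (b : Module.Basis ι K M) (X : Set (ℙ K M)) (s : ℕ) (δ : ℤ) : Prop :=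
  ∃ n d : ℕ, HasProjDim b X n ∧ HasProjDim b (secantVariety b X s) d ∧
    (expectedDim (Module.finrank K M - 1) n s : ℤ) - d = δ

end Projective

/-! ### The Plücker-embedded Grassmannian -/

/-- The basis `e_{i₁} ∧ ⋯ ∧ e_{iₖ}`, `i₁ < ⋯ < iₖ`, of `⋀^k(K^m)`. -/
def pluckerBasis (K : Type*) [Field K] (k m : ℕ) :
    Module.Basis (Set.powersetCard (Fin m) k) K (⋀[K]^k (Fin m → K)) :=
  (Pi.basisFun K (Fin m)).exteriorPower k

/-- The image of the Grassmannian of `k`-dimensional subspaces of `K^m` under the Plücker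
embedding: the points `[v₁ ∧ ⋯ ∧ vₖ]` with `v₁, …, vₖ` linearly independent. -/
def grassmannian (K : Type*) [Field K] (k m : ℕ) : Set (ℙ K (⋀[K]^k (Fin m → K))) :=
  {p | ∃ v : Fin k → (Fin m → K), LinearIndependent K v ∧
    p.submodule = Submodule.span K {exteriorPower.ιMulti K k v}}

/-! ### Squares of ideals in the exterior algebra -/

section Exterior

variable (K : Type*) {V : Type*} [Field K] [AddCommGroup V] [Module K V]

/-- The two-sided ideal of the exterior algebra generated by a set of vectors. -/
def vectorIdeal (A : Set V) : TwoSidedIdeal (ExteriorAlgebra K V) :=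
  TwoSidedIdeal.span (ExteriorAlgebra.ι K '' A)

/-- The square of the ideal generated by a set of vectors. -/
def squareIdeal (A : Set V) : TwoSidedIdeal (ExteriorAlgebra K V) :=
  TwoSidedIdeal.span {z | ∃ x ∈ vectorIdeal K A, ∃ y ∈ vectorIdeal K A, z = x * y}

/-- The degree `d` part of the intersection of the squares of the ideals generated by the sets of
vectors `A j`. -/
def squaresPiece {s : ℕ} (d : ℕ) (A : Fin s → Set V) : Submodule K (ExteriorAlgebra K V) where
  carrier := {x | x ∈ ⋀[K]^d V ∧ ∀ j, x ∈ squareIdeal K (A j)}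
  add_mem' hx hy := ⟨add_mem hx.1 hy.1, fun j => add_mem (hx.2 j) (hy.2 j)⟩
  zero_mem' := ⟨zero_mem _, fun j => zero_mem _⟩
  smul_mem' c x hx := ⟨Submodule.smul_mem _ c hx.1, fun j => by
    rw [Algebra.smul_def]
    exact TwoSidedIdeal.mul_mem_left _ _ _ (hx.2 j)⟩

/-- `Z = [(e₀,e₁,e₂)² ∩ (e₃,e₄,e₅)² ∩ (e₆,v,w)²]₄`. -/
def Z (e : Module.Basis (Fin 7) K V) (v w : V) : Submodule K (ExteriorAlgebra K V) :=
  squaresPiece K 4 ![{e 0, e 1, e 2}, {e 3, e 4, e 5}, {e 6, v, w}]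

/-- The bivector `Γ = c₀ e₁∧e₂ + c₁ e₁∧e₃ + c₂ e₁∧e₄ + c₃ e₂∧e₃ + c₄ e₂∧e₄ + c₅ e₃∧e₄`. -/
def bivector (e : Module.Basis (Fin 7) K V) (c : Fin 6 → K) : ExteriorAlgebra K V :=
  let x : Fin 7 → ExteriorAlgebra K V := fun i => ExteriorAlgebra.ι K (e i)
  c 0 • (x 1 * x 2) + c 1 • (x 1 * x 3) + c 2 • (x 1 * x 4) +
    c 3 • (x 2 * x 3) + c 4 • (x 2 * x 4) + c 5 • (x 3 * x 4)

end Exterior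

/-- The coefficient matrix of the linear system, in the parameters `b₀, …, b₅`. -/
def coeffMatrix {K : Type*} [Field K] (b : Fin 6 → K) : Matrix (Fin 6) (Fin 6) K :=
  !![b 3 - b 0, b 0 - b 2, 0, b 1 - b 0, 0, 0;
     b 4 - b 0, 0, b 0 - b 2, 0, b 1 - b 0, 0;
     b 5 - b 0, 0, 0, 0, 0, 0;
     0, 0, 0, 0, 0, b 5 - b 0;
     0, b 5 - b 4, b 3 - b 5, 0, 0, b 5 - b 1;
     0, 0, 0, b 5 - b 4, b 3 - b 5, b 5 - b 2]

/-- `P` holds for generic parameters in `K^σ`, that is, on a set that contains a nonempty Zariski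
open subset (a principal one) of the affine space. -/
def Generic {K σ : Type*} [Field K] (P : (σ → K) → Prop) : Prop :=
  ∃ f : MvPolynomial σ K, f ≠ 0 ∧ ∀ x : σ → K, MvPolynomial.eval x f ≠ 0 → P x

end SecantGrassmann

end

/-!
The dimension of a cone with a polynomial parametrization is computed from two sides. Its
homogeneous coordinate ring is the quotient of the polynomial ring by the kernel of the comorphism
(`homogeneousIdeal_eq_ker`), a finitely generated domain, so its Krull dimension is its
transcendence degree (`exists_ringKrullDim_eq_trdeg`). Coordinates whose differentials are
independent at one point are algebraically independent (`algebraicIndependent_of_jacobian`), and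
for sums of `s` decomposable trivectors the differentials are evaluated on tangent spaces: this is
Terracini's lemma (`algebraicIndependent_secantPoly`). Upper bounds come from a chart with few
parameters or from a single equation.

* The Grassmannian: 13 Plücker coordinates are independent on the tangent space at
  `e₀ ∧ e₁ ∧ e₂`, and the cone is the closure of the image of the 13-dimensional chart
  `λ • (I | x)`. So the dimension is `12`.
* Lower bound for the variety of secant planes: a trivector form that vanishes on the tangent
  spaces at `e₀ ∧ e₁ ∧ e₂`, `e₃ ∧ e₄ ∧ e₅`, `e₆ ∧ v ∧ w`, for `v`, `w` congruent to `e₀ + e₃` and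
  `e₁ + e₄` modulo `e₆`, is determined by its value on `e₂ ∧ e₅ ∧ e₆`
  (`alternating_eq_zero_of_tangent`). So all but one of the 35 coordinates are independent.
* Upper bound: for a decomposable trivector `x`, multiplication by `x` has rank at most `6` on
  the `21`-dimensional space of bivectors, since in an adapted basis only the bivectors in a
  complementary `4`-space survive. For a sum of three such `x` the rank is at most `18`, hence
  the determinant of the form `(a, c) ↦ a ∧ x ∧ c` vanishes (`wedgeDet_mem_ker`). It does not
  vanish at `e₀₁₂ + e₀₃₄ + e₀₅₆ + e₁₃₅ + e₂₄₆` (`eq_zero_of_mul_genericTrivector`). So the variety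
  is a hypersurface, and it is not the whole space.

For the space `Z`, wedging with trivectors identifies `⋀⁴` with the trivector forms. An element of
the square of the ideal of a 3-space `⟨a, b, c⟩` is annihilated by the products of two vectors of
that space (`mul_ι_mul_ι_eq_zero`), so the forms that come from `Z` vanish on the three tangent
spaces, and the Terracini computation gives `dim Z ≤ 1`. In a basis adapted to `v` and `w`,
the vector `e₀ ∧ e₁ ∧ e₃ ∧ e₄` is an element of `Z` (`finrank_Z_of_adapted`). For `v`, `w` in
`⟨e₀, …, e₅⟩` the product `v ∧ w ∧ Γ` is always in the third square, and it is in the first two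
exactly if six of its wedge products with `e_p ∧ e_q ∧ e₆` vanish; these are the rows of the linear
system (`wedgeForm_eq_mulVec`, `mem_Z_iff_mulVec_eq_zero`).
-/

noncomputable section

namespace SecantGrassmann

/-! ### Krull dimension and transcendence degree -/

section KrullDimension

/-- Integral extensions preserve the Krull dimension: chains of primes contract strictly by
incomparability and lift by going up. -/
theorem ringKrullDim_eq_of_isIntegral {R S : Type*} [CommRing R] [CommRing S] [Algebra R S]
    [Algebra.IsIntegral R S] (hinj : Function.Injective (algebraMap R S)) :
    ringKrullDim S = ringKrullDim R := by
  apply le_antisymm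
  · refine Order.krullDim_le_of_strictMono (PrimeSpectrum.comap (algebraMap R S)) ?_
    intro P Q h
    exact Ideal.IsIntegral.comap_lt_comap (R := R) (I := P.asIdeal) (J := Q.asIdeal) h
  · refine iSup_le fun l => ?_
    obtain ⟨P, -, hP, hPl⟩ := Ideal.exists_ideal_over_prime_of_isIntegral (S := S)
      l.head.asIdeal ⊥ (by
        rw [← RingHom.ker_eq_comap_bot, (RingHom.injective_iff_ker_eq_bot _).1 hinj]
        exact bot_le)
    have : P.LiesOver l.head.asIdeal := ⟨hPl.symm⟩
    obtain ⟨L, hL, -⟩ := Ideal.exists_ltSeries_of_hasGoingUp (S := S) l P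
    rw [← hL]
    exact Order.LTSeries.length_le_krullDim L

/-- The Krull dimension of a finitely generated domain over a field is its transcendence degree, by
Noether normalization. -/
theorem exists_ringKrullDim_eq_trdeg (k A : Type*) [Field k] [CommRing A] [IsDomain A]
    [Algebra k A] [Algebra.FiniteType k A] :
    ∃ s : ℕ, ringKrullDim A = s ∧ Algebra.trdeg k A = s := by
  obtain ⟨s, g, hg, hint⟩ := exists_integral_inj_algHom_of_fg k A
  refine ⟨s, ?_, ?_⟩
  · let _ := g.toRingHom.toAlgebra
    have : Algebra.IsIntegral (MvPolynomial (Fin s) k) A := ⟨hint⟩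
    rw [ringKrullDim_eq_of_isIntegral (R := MvPolynomial (Fin s) k) (S := A) hg]
    simp [MvPolynomial.ringKrullDim_of_isNoetherianRing]
  · let _ := g.toRingHom.toAlgebra
    have : Algebra.IsIntegral (MvPolynomial (Fin s) k) A := ⟨hint⟩
    have : IsScalarTower k (MvPolynomial (Fin s) k) A :=
      IsScalarTower.of_algebraMap_eq fun x => (g.commutes x).symm
    have : FaithfulSMul (MvPolynomial (Fin s) k) A :=
      (faithfulSMul_iff_algebraMap_injective _ _).2 hg
    have h := lift_trdeg_add_eq k (MvPolynomial (Fin s) k) A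
    rw [trdeg_eq_zero (R := MvPolynomial (Fin s) k) (A := A),
      MvPolynomial.trdeg_of_isDomain] at h
    simpa [eq_comm] using h

theorem card_le_ringKrullDim_of_algebraicIndependent {k A κ : Type*} [Field k] [CommRing A]
    [IsDomain A] [Algebra k A] [Algebra.FiniteType k A] [Fintype κ] {x : κ → A}
    (hx : AlgebraicIndependent k x) : (Fintype.card κ : WithBot ℕ∞) ≤ ringKrullDim A := by
  obtain ⟨s, h1, h2⟩ := exists_ringKrullDim_eq_trdeg k A
  have h := hx.lift_cardinalMk_le_trdeg
  rw [h2] at h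
  simp only [Cardinal.mk_fintype, Cardinal.lift_natCast, Nat.cast_le] at h
  rw [h1]
  exact_mod_cast h

theorem ringKrullDim_le_card_of_injective {k A τ : Type*} [Field k] [CommRing A]
    [IsDomain A] [Algebra k A] [Algebra.FiniteType k A] [Fintype τ]
    (g : A →ₐ[k] MvPolynomial τ k) (hg : Function.Injective g) :
    ringKrullDim A ≤ (Fintype.card τ : WithBot ℕ∞) := by
  obtain ⟨s, h1, h2⟩ := exists_ringKrullDim_eq_trdeg k A
  have h := lift_trdeg_le_of_injective g hg
  rw [h2, MvPolynomial.trdeg_of_isDomain] at h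
  simp only [Cardinal.mk_fintype, Cardinal.lift_natCast, Nat.cast_le] at h
  rw [h1]
  exact_mod_cast h

end KrullDimension

/-! ### The Jacobian criterion -/

section Jacobian

open MvPolynomial

/-- The chain rule for polynomials. -/
theorem pderiv_aeval {k κ τ : Type*} [CommRing k] [Fintype κ] (f : κ → MvPolynomial τ k)
    (j : τ) (F : MvPolynomial κ k) :
    pderiv j (aeval f F) = ∑ i, pderiv j (f i) * aeval f (pderiv i F) := by
  classical
  induction F using MvPolynomial.induction_on with
  | C a => simp
  | add p q hp hq => simp only [map_add, hp, hq, mul_add, Finset.sum_add_distrib]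
  | mul_X p n hp =>
    simp only [map_mul, aeval_X, pderiv_mul, hp, map_add, mul_add, Finset.sum_add_distrib,
      Finset.sum_mul, pderiv_X]
    congr 1
    · exact Finset.sum_congr rfl fun i _ => by ring
    · rw [Finset.sum_eq_single n (fun i _ hi => by simp [hi.symm]) (by simp)]
      simp [mul_comm]

theorem totalDegree_pderiv_le {k κ : Type*} [CommRing k] {F : MvPolynomial κ k} {n : ℕ}
    (hF : F.totalDegree ≤ n + 1) (i : κ) : (pderiv i F).totalDegree ≤ n := by
  refine Finset.sup_le fun m hm => ?_
  rw [mem_support_iff, coeff_pderiv] at hm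
  have h := le_totalDegree (mem_support_iff.2 (left_ne_zero_of_mul hm))
  rw [Finsupp.sum_add_index' (fun _ => rfl) (fun _ _ _ => rfl), Finsupp.sum_single_index rfl] at h
  have := h.trans hF
  omega

theorem eq_C_of_pderiv_eq_zero {k κ : Type*} [Field k] [CharZero k] {F : MvPolynomial κ k}
    (h : ∀ i, pderiv i F = 0) : F = C (coeff 0 F) := by
  classical
  ext m
  rw [coeff_C]
  split_ifs with hm
  · rw [hm]
  · obtain ⟨i, hi⟩ : ∃ i, m i ≠ 0 := by
      by_contra! hc
      exact hm (Finsupp.ext fun i => by simp [hc i])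
    have hle : Finsupp.single i 1 ≤ m := by
      rw [Finsupp.single_le_iff]; omega
    have := coeff_pderiv (i := i) F (m - Finsupp.single i 1)
    rw [h i, tsub_add_cancel_of_le hle, coeff_zero] at this
    refine (mul_eq_zero.1 this.symm).resolve_right ?_
    exact Nat.cast_add_one_ne_zero _

/-- The Jacobian criterion in characteristic zero: polynomials whose differentials at one point
are linearly independent are algebraically independent.  A nonzero relation of least degree would,
after differentiation, produce a relation of smaller degree. -/
theorem algebraicIndependent_of_jacobian {k κ τ : Type*} [Field k] [CharZero k] [Fintype κ]
    [Fintype τ] (f : κ → MvPolynomial τ k) (p : τ → k)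
    (h : ∀ c : κ → k, (∀ j, ∑ i, eval p (pderiv j (f i)) * c i = 0) → c = 0) :
    AlgebraicIndependent k f := by
  classical
  let J : Matrix τ κ (MvPolynomial τ k) := Matrix.of fun j i => pderiv j (f i)
  -- a left inverse `N` of the Jacobian matrix at `p`; then `det (N * J)` has value `1` at `p`
  have hJp : Function.Injective (Matrix.toLin' (J.map (eval p))) := by
    rw [← LinearMap.ker_eq_bot, LinearMap.ker_eq_bot']
    intro c hc
    refine h c fun j => ?_
    simpa [J, Matrix.mulVec, dotProduct] using congrFun hc j
  obtain ⟨g, hg⟩ := LinearMap.exists_leftInverse_of_injective _ (LinearMap.ker_eq_bot.2 hJp)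
  let N : Matrix κ τ k := LinearMap.toMatrix' g
  have hN : N * J.map (eval p) = 1 := by
    have := congrArg LinearMap.toMatrix' hg
    rwa [LinearMap.toMatrix'_comp, LinearMap.toMatrix'_toLin', LinearMap.toMatrix'_id] at this
  let N' : Matrix κ τ (MvPolynomial τ k) := N.map C
  have hdet : (N' * J).det ≠ 0 := by
    intro h0
    have h1 := congrArg (eval p) h0
    rw [RingHom.map_det, RingHom.mapMatrix_apply, Matrix.map_mul] at h1
    have h2 : N'.map (eval p) = N := by ext i j; simp [N']
    rw [h2, hN] at h1
    simp at h1
  have key : ∀ n : ℕ, ∀ F : MvPolynomial κ k, F.totalDegree ≤ n → aeval f F = 0 → F = 0 := by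
    intro n
    induction n with
    | zero =>
      intro F hF h0
      rw [totalDegree_eq_zero_iff_eq_C.1 (Nat.le_zero.1 hF)] at h0 ⊢
      simpa using h0
    | succ n ih =>
      intro F hF h0
      -- by the chain rule the relations `∂F/∂xᵢ (f)` form a vector in the kernel of `J`
      have hv : (fun i => aeval f (pderiv i F)) = (0 : κ → MvPolynomial τ k) := by
        refine Matrix.eq_zero_of_mulVec_eq_zero hdet ?_
        rw [← Matrix.mulVec_mulVec]
        have : J.mulVec (fun i => aeval f (pderiv i F)) = 0 := by
          ext1 j
          have := pderiv_aeval f j F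
          rw [h0, map_zero] at this
          simpa [J, Matrix.mulVec, dotProduct] using this.symm
        rw [this, Matrix.mulVec_zero]
      have hd : ∀ i, pderiv i F = 0 := fun i =>
        ih _ (totalDegree_pderiv_le hF i) (congrFun hv i)
      rw [eq_C_of_pderiv_eq_zero hd] at h0 ⊢
      simpa using h0
  rw [algebraicIndependent_iff]
  exact fun F => key _ F le_rfl

/-- The partial derivative of a polynomial whose restriction to a coordinate line is affine. -/
theorem eval_pderiv_of_affine {k τ : Type*} [Field k] [Infinite k] [DecidableEq τ]
    (F : MvPolynomial τ k) (p : τ → k) (j : τ) (a b : k)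
    (h : ∀ c : k, eval (p + Pi.single j c) F = a + c * b) : eval p (pderiv j F) = b := by
  -- the restriction to the line through `p` in the direction `j`
  let g : MvPolynomial τ k →ₐ[k] Polynomial k :=
    aeval fun i => Polynomial.C (p i) + Pi.single (M := fun _ => Polynomial k) j Polynomial.X i
  have hg : ∀ (c : k) (G : MvPolynomial τ k),
      (g G).eval c = eval (p + Pi.single j c) G := by
    intro c G
    have : ((Polynomial.evalRingHom c).comp (g : MvPolynomial τ k →+* Polynomial k)) =
        (eval (p + Pi.single j c) : MvPolynomial τ k →+* k) := by
      ext i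
      · simp [g]
      · by_cases hi : i = j
        · subst hi; simp [g]
        · simp [g, hi]
    exact RingHom.congr_fun this G
  have hd : ∀ G : MvPolynomial τ k, Polynomial.derivative (g G) = g (pderiv j G) := by
    intro G
    induction G using MvPolynomial.induction_on with
    | C a => simp [g]
    | add p q hp hq => simp [hp, hq]
    | mul_X q n hq =>
      have : Polynomial.derivative (g (X n)) = g (pderiv j (X n)) := by
        by_cases hi : n = j
        · subst hi; simp [g]
        · simp [g, hi, pderiv_X_of_ne hi]
      simp only [map_mul, Polynomial.derivative_mul, hq, this, pderiv_mul, map_add]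
  have h1 : g F = Polynomial.C a + Polynomial.X * Polynomial.C b := by
    refine Polynomial.funext fun c => ?_
    rw [hg, h]; simp only [Polynomial.eval_add, Polynomial.eval_C, Polynomial.eval_mul,
      Polynomial.eval_X]
  have h2 := hg 0 (pderiv j F)
  rw [← hd, h1] at h2
  simpa using h2.symm

end Jacobian

/-! ### Cones with a polynomial parametrization -/

section Parametrized

open MvPolynomial

variable {K M ι : Type*} [Field K] [AddCommGroup M] [Module K M] [Finite ι]

/-- Passing to the Zariski closure does not change the homogeneous ideal. -/
theorem homogeneousIdeal_zariskiClosure (b : Module.Basis ι K M) (S : Set (ℙ K M)) :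
    homogeneousIdeal b (zariskiClosure b S) = homogeneousIdeal b S := by
  apply le_antisymm
  · refine vanishingIdeal_anti_mono ?_
    rintro y ⟨p, hp, x, hx, rfl⟩
    refine ⟨p, fun z hz => ?_, x, hx, rfl⟩
    exact zeroLocus_vanishingIdeal_le _ ⟨p, hp, z, hz, rfl⟩
  · refine le_zeroLocus_iff_le_vanishingIdeal.1 ?_
    rintro y ⟨p, hp, x, hx, rfl⟩
    exact hp x hx

theorem HasProjDim.zariskiClosure {b : Module.Basis ι K M} {S : Set (ℙ K M)} {d : ℕ}
    (h : HasProjDim b S d) : HasProjDim b (zariskiClosure b S) d := by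
  unfold HasProjDim
  rwa [homogeneousIdeal_zariskiClosure]

/-- The ideal of a cone with a polynomial parametrization consists of the relations between the
parametrizing polynomials. -/
theorem homogeneousIdeal_eq_ker [Infinite K] {τ : Type*} {b : Module.Basis ι K M}
    {S : Set (ℙ K M)} (f : ι → MvPolynomial τ K)
    (h : affineCone b S = Set.range fun t i => eval t (f i)) :
    homogeneousIdeal b S = RingHom.ker (aeval f) := by
  ext F
  have key : ∀ t : τ → K, aeval (fun i => eval t (f i)) F = eval t (aeval f F) := by
    intro t
    rw [← aeval_eq_eval, ← AlgHom.comp_apply]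
    congr 1
    ext i
    simp
  rw [homogeneousIdeal, mem_vanishingIdeal_iff, h, RingHom.mem_ker, MvPolynomial.funext_iff]
  simp only [Set.forall_mem_range, key, map_zero]

theorem card_le_ringKrullDim_quotient_ker {τ κ : Type*} [Fintype κ] (f : ι → MvPolynomial τ K)
    (g : κ → ι) (h : AlgebraicIndependent K (f ∘ g)) :
    (Fintype.card κ : WithBot ℕ∞) ≤
      ringKrullDim (MvPolynomial ι K ⧸ RingHom.ker (aeval (R := K) f)) := by
  have : (RingHom.ker (aeval (R := K) f)).IsPrime := RingHom.ker_isPrime _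
  refine card_le_ringKrullDim_of_algebraicIndependent (k := K)
    (x := fun i => Ideal.Quotient.mk (RingHom.ker (aeval (R := K) f)) (X (g i))) ?_
  refine AlgebraicIndependent.of_comp (Ideal.kerLiftAlg (aeval (R := K) f)) ?_
  convert h using 1
  ext1 i
  exact aeval_X f (g i)

theorem ringKrullDim_quotient_ker_le_card {τ : Type*} [Fintype τ] (f : ι → MvPolynomial τ K) :
    ringKrullDim (MvPolynomial ι K ⧸ RingHom.ker (aeval (R := K) f)) ≤
      (Fintype.card τ : WithBot ℕ∞) := by
  have : (RingHom.ker (aeval (R := K) f)).IsPrime := RingHom.ker_isPrime _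
  exact ringKrullDim_le_card_of_injective (k := K) (Ideal.kerLiftAlg (aeval (R := K) f))
    (Ideal.kerLiftAlg_injective _)

/-- A nonzero ideal of a polynomial ring cuts the dimension down by at least one, as it contains
a non-zero-divisor. -/
theorem ringKrullDim_quotient_add_one_le [Fintype ι] {I : Ideal (MvPolynomial ι K)}
    (hI : I ≠ ⊥) : ringKrullDim (MvPolynomial ι K ⧸ I) + 1 ≤ (Fintype.card ι : WithBot ℕ∞) := by
  obtain ⟨F, hF, hF0⟩ := Submodule.exists_mem_ne_zero_of_ne_bot hI
  have h := ringKrullDim_quotient_succ_le_of_nonZeroDivisor (mem_nonZeroDivisors_of_ne_zero hF0)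
  rw [ringKrullDim_of_isNoetherianRing, ringKrullDim_eq_zero_of_field, zero_add,
    Nat.card_eq_fintype_card] at h
  refine le_trans ?_ h
  gcongr
  have hle : Ideal.span {F} ≤ I := (Ideal.span_singleton_le_iff_mem _).2 hF
  exact ringKrullDim_le_of_surjective (Ideal.Quotient.factor hle)
    (Ideal.Quotient.factor_surjective hle)

end Parametrized

/-! ### The pairing of complementary degrees in the exterior algebra -/

section TopForm

variable {K V : Type*} [Field K] [AddCommGroup V] [Module K V]

open ExteriorAlgebra

/-- The linear form on the exterior algebra that reads off the coefficient of
`e₀ ∧ ⋯ ∧ e_{n-1}`. -/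
def topForm {n : ℕ} (e : Module.Basis (Fin n) K V) : ExteriorAlgebra K V →ₗ[K] K :=
  liftAlternating (Pi.single n e.det)

theorem topForm_ιMulti {n : ℕ} (e : Module.Basis (Fin n) K V) (v : Fin n → V) :
    topForm e (ιMulti K n v) = e.det v := by
  simp [topForm, liftAlternating_apply_ιMulti]

theorem det_comp_of_injective {n : ℕ} (e : Module.Basis (Fin n) K V) {g : Fin n → Fin n}
    (hg : Function.Injective g) : e.det (e ∘ g) ≠ 0 := by
  have h := e.det.map_perm e (Equiv.ofBijective g (Finite.injective_iff_bijective.1 hg))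
  rw [e.det_self] at h
  change e.det (e ∘ g) = _ at h
  rw [h]
  rcases Int.units_eq_one_or (Equiv.Perm.sign
    (Equiv.ofBijective g (Finite.injective_iff_bijective.1 hg))) with h | h <;> simp [h]

/-- The sign of the tuple `f` of indices: the sign of the permutation `f`, and zero if an index is
repeated. -/
def tupleSign {n : ℕ} (f : Fin n → Fin n) : ℤ :=
  ∏ j, ∏ i ∈ Finset.Iio j, if f i < f j then 1 else if f j < f i then -1 else 0

theorem det_comp_eq_tupleSign {n : ℕ} (e : Module.Basis (Fin n) K V) (f : Fin n → Fin n) :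
    e.det (e ∘ f) = (tupleSign f : K) := by
  by_cases hf : Function.Injective f
  · let σ := Equiv.ofBijective f (Finite.injective_iff_bijective.1 hf)
    have h := e.det.map_perm e σ
    rw [e.det_self] at h
    change e.det (e ∘ f) = _ at h
    have hs : ((Equiv.Perm.sign σ : ℤˣ) : ℤ) = tupleSign f := by
      rw [Equiv.Perm.sign_eq_prod_prod_Iio]
      push_cast
      refine Finset.prod_congr rfl fun j _ => Finset.prod_congr rfl fun i hi => ?_
      have hne : f i ≠ f j := hf.ne (Finset.mem_Iio.1 hi).ne
      change ((if f i < f j then 1 else -1 : ℤˣ) : ℤ) = _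
      rcases lt_or_gt_of_ne hne with h1 | h1
      · simp [h1]
      · simp [h1, h1.not_gt]
    rw [h, ← hs]
    rcases Int.units_eq_one_or (Equiv.Perm.sign σ) with h | h <;> simp [h]
  · rw [e.det.map_eq_zero_of_not_injective _ fun h => hf h.of_comp]
    obtain ⟨i, j, hij, hne⟩ : ∃ i j, f i = f j ∧ i < j := by
      simp only [Function.Injective, not_forall] at hf
      obtain ⟨i, j, hij, hne⟩ := hf
      rcases lt_or_gt_of_ne hne with h | h
      exacts [⟨i, j, hij, h⟩, ⟨j, i, hij.symm, h⟩]
    have : tupleSign f = 0 := Finset.prod_eq_zero (Finset.mem_univ j)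
      (Finset.prod_eq_zero (Finset.mem_Iio.2 hne) (by simp [hij]))
    simp [this]

/-- Wedging with the complementary basis vector `e_{Sᶜ}` and taking the top coefficient reads off
the coordinate at `e_S`, up to sign. -/
theorem exists_topForm_mul_eq {n p q : ℕ} (h : p + q = n) (e : Module.Basis (Fin n) K V)
    (S : Set.powersetCard (Fin n) p) :
    ∃ f : Fin q → Fin n, (∀ i, i ∈ Set.range f ↔ i ∉ S) ∧ ∃ u : K, u ≠ 0 ∧
      ∀ z : ⋀[K]^p V, topForm e (z * ιMulti K q (e ∘ f)) = u * (e.exteriorPower p).repr z S := by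
  subst h
  let T : Set.powersetCard (Fin (p + q)) q := Set.powersetCard.compl (by simp [add_comm]) S
  have hST : Disjoint S.val T.val := by
    rw [Set.powersetCard.coe_compl]; exact disjoint_compl_right
  refine ⟨Set.powersetCard.ofFinEmbEquiv.symm T, fun i => ?_,
    topForm e (ExteriorAlgebra.ιMulti_family K p e S * ExteriorAlgebra.ιMulti_family K q e T),
    ?_, ?_⟩
  · rw [Set.powersetCard.mem_range_ofFinEmbEquiv_symm_iff_mem, Set.powersetCard.mem_compl]
  · rw [ιMulti_family_mul_of_disjoint K e S T hST, map_zsmul_unit, topForm_ιMulti]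
    intro h0
    refine det_comp_of_injective e (Set.powersetCard.ofFinEmbEquiv.symm
      (Set.powersetCard.disjUnion hST)).injective ?_
    rcases Int.units_eq_one_or (Set.powersetCard.permOfDisjoint hST).sign with h | h <;>
      simpa [h] using h0
  · intro z
    let A : ⋀[K]^p V →ₗ[K] K := topForm e ∘ₗ
      LinearMap.mulRight K (ιMulti K q (e ∘ Set.powersetCard.ofFinEmbEquiv.symm T)) ∘ₗ
        (⋀[K]^p V).subtype
    let B : ⋀[K]^p V →ₗ[K] K := topForm e (ExteriorAlgebra.ιMulti_family K p e S *
      ExteriorAlgebra.ιMulti_family K q e T) • (e.exteriorPower p).coord S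
    suffices A = B from LinearMap.congr_fun this z
    refine (e.exteriorPower p).ext fun U => ?_
    by_cases hU : U = S
    · subst hU
      simp [A, B, exteriorPower.basis_apply]
    · have hd : ¬ Disjoint U.val T.val := by
        rw [Set.powersetCard.coe_compl, disjoint_compl_right_iff]
        exact fun hle => hU (Set.powersetCard.eq_iff_subset.2 hle)
      have := ιMulti_family_mul_of_not_disjoint K e U T hd
      simp only [ExteriorAlgebra.ιMulti_family] at this
      simp [A, B, exteriorPower.basis_apply, this, exteriorPower.basis_repr_ne _ _ _ hU]

/-- The pairing between complementary degrees of the exterior algebra is nondegenerate. -/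
theorem eq_zero_of_topForm_mul_eq_zero {n p q : ℕ} (h : p + q = n) (e : Module.Basis (Fin n) K V)
    {z : ExteriorAlgebra K V} (hz : z ∈ ⋀[K]^p V)
    (H : ∀ v : Fin q → V, topForm e (z * ιMulti K q v) = 0) : z = 0 := by
  have : (⟨z, hz⟩ : ⋀[K]^p V) = 0 := by
    refine (e.exteriorPower p).ext_elem fun S => ?_
    obtain ⟨f, -, u, hu, hf⟩ := exists_topForm_mul_eq h e S
    have := hf ⟨z, hz⟩
    rw [H] at this
    simpa [hu] using this.symm
  exact congrArg Subtype.val this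

/-- The alternating form `v ↦ z ∧ v₁ ∧ ⋯ ∧ v_q`, with values read off by `topForm`. -/
def wedgeForm {n : ℕ} (e : Module.Basis (Fin n) K V) (q : ℕ) (z : ExteriorAlgebra K V) :
    V [⋀^Fin q]→ₗ[K] K :=
  (topForm e ∘ₗ LinearMap.mulLeft K z).compAlternatingMap (ιMulti K q)

@[simp]
theorem wedgeForm_apply {n : ℕ} (e : Module.Basis (Fin n) K V) (q : ℕ) (z : ExteriorAlgebra K V)
    (v : Fin q → V) : wedgeForm e q z v = topForm e (z * ιMulti K q v) := rfl

theorem eq_zero_of_wedgeForm_eq_zero {n p q : ℕ} (h : p + q = n) (e : Module.Basis (Fin n) K V)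
    {z : ExteriorAlgebra K V} (hz : z ∈ ⋀[K]^p V) (H : wedgeForm e q z = 0) : z = 0 :=
  eq_zero_of_topForm_mul_eq_zero h e hz fun v => by rw [← wedgeForm_apply, H]; rfl

end TopForm

/-! ### Alternating forms and tangent spaces of the Grassmannian -/

section Trilinear

variable {K V W : Type*} [Field K] [AddCommGroup V] [Module K V] [AddCommGroup W] [Module K W]

/-- Vanishing of an alternating map on a family `e ∘ g` depends only on the indices that occur: if
every entry of `f` is an entry of `g`, then `f` either rearranges `g` or repeats an entry. -/
theorem map_eq_zero_of_range {n q : ℕ} (t : V [⋀^Fin q]→ₗ[K] W) (e : Fin n → V)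
    {f g : Fin q → Fin n} (hfg : ∀ i, ∃ j, f i = g j) (hg : t (fun i => e (g i)) = 0) :
    t (fun i => e (f i)) = 0 := by
  by_cases hf : Function.Injective f
  · choose σ hσ using hfg
    have hinj : Function.Injective σ := fun i j hij => hf (by rw [hσ, hσ, hij])
    have h := t.map_perm (fun i => e (g i))
      (Equiv.ofBijective σ (Finite.injective_iff_bijective.1 hinj))
    rw [hg, smul_zero] at h
    rw [← h]
    congr 1
    ext i
    simp [hσ]
  · exact t.map_eq_zero_of_not_injective _ fun h => hf fun i j hij => h (by simp [hij])

theorem alternatingMap_ext_of_strictMono {I : Type*} [LinearOrder I] {q : ℕ}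
    (e : Module.Basis I K V) {s t : V [⋀^Fin q]→ₗ[K] W}
    (h : ∀ f : Fin q → I, StrictMono f → s (fun i => e (f i)) = t fun i => e (f i)) : s = t := by
  refine (exteriorPower.alternatingMapLinearEquiv (R := K)).injective
    ((e.exteriorPower q).ext fun S => ?_)
  have := h _ (Set.powersetCard.ofFinEmbEquiv.symm S).strictMono
  simpa [exteriorPower.basis_apply, exteriorPower.ιMulti_family, Function.comp_def] using this

set_option maxRecDepth 10000 in
/-- Terracini's computation for three general points of the Grassmannian.  A trivector form on
a `7`-dimensional space that vanishes on `a ∧ a' ∧ x` for `a, a'` in one of the three spaces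
`⟨e₀, e₁, e₂⟩`, `⟨e₃, e₄, e₅⟩`, `⟨e₆, v, w⟩` is determined by its value on `e₂ ∧ e₅ ∧ e₆`. -/
theorem alternating_eq_zero_of_tangent (e : Module.Basis (Fin 7) K V) {v w : V} {α β : K}
    (hv : v = e 0 + e 3 + α • e 6) (hw : w = e 1 + e 4 + β • e 6) (t : V [⋀^Fin 3]→ₗ[K] K)
    (hA01 : ∀ x, t ![e 0, e 1, x] = 0) (hA02 : ∀ x, t ![e 0, e 2, x] = 0)
    (hA12 : ∀ x, t ![e 1, e 2, x] = 0)
    (hB34 : ∀ x, t ![e 3, e 4, x] = 0) (hB35 : ∀ x, t ![e 3, e 5, x] = 0)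
    (hB45 : ∀ x, t ![e 4, e 5, x] = 0)
    (hCv : ∀ x, t ![e 6, v, x] = 0) (hCw : ∀ x, t ![e 6, w, x] = 0)
    (h256 : t ![e 2, e 5, e 6] = 0) : t = 0 := by
  have hcons : ∀ i j k : Fin 7, (fun l => e (![i, j, k] l)) = ![e i, e j, e k] := by
    intro i j k; ext1 l; fin_cases l <;> rfl
  have perm : ∀ i j k i' j' k' : Fin 7, (∀ l, ∃ m, ![i', j', k'] l = ![i, j, k] m) →
      t ![e i, e j, e k] = 0 → t ![e i', e j', e k'] = 0 := by
    intro i j k i' j' k' h h0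
    rw [← hcons] at h0 ⊢
    exact map_eq_zero_of_range t e h h0
  have add : ∀ x y z : V, ∀ c : K, t ![e 6, x + y + c • e 6, z] =
      t ![e 6, x, z] + t ![e 6, y, z] := by
    intro x y z c
    have h1 := t.map_update_add ![e 6, 0, z] 1 (x + y) (c • e 6)
    have h2 := t.map_update_add ![e 6, 0, z] 1 x y
    have h3 := t.map_update_smul ![e 6, 0, z] 1 c (e 6)
    have h4 : t ![e 6, e 6, z] = 0 :=
      t.map_eq_zero_of_eq _ (i := 0) (j := 1) rfl (by decide)
    have hu : ∀ y, Function.update ![e 6, 0, z] 1 y = ![e 6, y, z] := by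
      intro y; ext1 l; fin_cases l <;> rfl
    simp only [hu] at h1 h2 h3
    rw [h1, h2, h3, h4, smul_zero, add_zero]
  have hv' : ∀ x, t ![e 6, e 0, x] + t ![e 6, e 3, x] = 0 := fun x => by
    rw [← add _ _ _ α, ← hv, hCv]
  have hw' : ∀ x, t ![e 6, e 1, x] + t ![e 6, e 4, x] = 0 := fun x => by
    rw [← add _ _ _ β, ← hw, hCw]
  -- For `i ∈ {0, 1, 2}` and `j ∈ {3, 4, 5}`, the vectors `e_i ∧ e_j ∧ e₆` are not covered by the
  -- first two tangent spaces. The relations `hv'`, `hw'` reduce them to vectors that are, except for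
  -- `e₂ ∧ e₅ ∧ e₆`.
  have rot : ∀ a j : Fin 7, ∀ l, ∃ m, ![6, a, j] l = ![a, j, 6] m := by decide
  have h60 : ∀ j : Fin 7, t ![e 3, e j, e 6] = 0 → t ![e 6, e 0, e j] = 0 := by
    intro j h
    have h' := hv' (e j)
    rwa [perm 3 j 6 6 3 j (rot _ _) h, add_zero] at h'
  have h61 : ∀ j : Fin 7, t ![e 4, e j, e 6] = 0 → t ![e 6, e 1, e j] = 0 := by
    intro j h
    have h' := hw' (e j)
    rwa [perm 4 j 6 6 4 j (rot _ _) h, add_zero] at h'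
  have h03 := h60 3 (t.map_eq_zero_of_eq _ (i := 0) (j := 1) rfl (by decide))
  have h04 := h60 4 (hB34 _)
  have h05 := h60 5 (hB35 _)
  have h13 := h61 3 (perm 3 4 6 4 3 6 (by decide) (hB34 _))
  have h14 := h61 4 (t.map_eq_zero_of_eq _ (i := 0) (j := 1) rfl (by decide))
  have h15 := h61 5 (hB45 _)
  have h23 : t ![e 6, e 3, e 2] = 0 := by
    have h' := hv' (e 2)
    rwa [perm 0 2 6 6 0 2 (by decide) (hA02 _), zero_add] at h'
  have h24 : t ![e 6, e 4, e 2] = 0 := by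
    have h' := hw' (e 2)
    rwa [perm 1 2 6 6 1 2 (by decide) (hA12 _), zero_add] at h'
  have cover : ∀ i j k : Fin 7, i < j → j < k →
      (∃ p ∈ [((0 : Fin 7), (1 : Fin 7)), (0, 2), (1, 2), (3, 4), (3, 5), (4, 5)],
        ∃ x : Fin 7, ∀ l, ∃ m, ![i, j, k] l = ![p.1, p.2, x] m) ∨
      (∃ p ∈ [((0 : Fin 7), (3 : Fin 7)), (0, 4), (0, 5), (1, 3), (1, 4), (1, 5), (3, 2), (4, 2)],
        ∀ l, ∃ m, ![i, j, k] l = ![6, p.1, p.2] m) ∨ ![i, j, k] = ![2, 5, 6] := by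
    decide
  refine alternatingMap_ext_of_strictMono e fun f hf => ?_
  have hf' : (fun l => e (f l)) = ![e (f 0), e (f 1), e (f 2)] := by
    ext1 l; fin_cases l <;> rfl
  rw [hf', AlternatingMap.zero_apply]
  obtain ⟨p, hp, x, hx⟩ | ⟨p, hp, hx⟩ | h := cover (f 0) (f 1) (f 2) (hf (by decide))
    (hf (by decide))
  · refine perm _ _ _ _ _ _ hx ?_
    simp only [List.mem_cons, List.not_mem_nil, or_false] at hp
    rcases hp with rfl | rfl | rfl | rfl | rfl | rfl
    exacts [hA01 _, hA02 _, hA12 _, hB34 _, hB35 _, hB45 _]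
  · refine perm _ _ _ _ _ _ hx ?_
    simp only [List.mem_cons, List.not_mem_nil, or_false] at hp
    rcases hp with rfl | rfl | rfl | rfl | rfl | rfl | rfl | rfl
    exacts [h03, h04, h05, h13, h14, h15, h23, h24]
  · rw [show f 0 = 2 from congrFun h 0, show f 1 = 5 from congrFun h 1,
      show f 2 = 6 from congrFun h 2, h256]

end Trilinear

/-! ### Squares of ideals generated by three vectors -/

section Ideals

variable {K V : Type*} [Field K] [AddCommGroup V] [Module K V]

open ExteriorAlgebra

/-- A vector moves past an element of the exterior algebra at the cost of the grade involution. -/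
theorem ι_mul_eq_involute_mul (a : V) (s : ExteriorAlgebra K V) :
    ι K a * s = CliffordAlgebra.involute s * ι K a := by
  induction s using ExteriorAlgebra.induction with
  | algebraMap r => rw [AlgHom.commutes]; exact (Algebra.commutes r _).symm
  | ι v =>
    have h : CliffordAlgebra.involute (ι K v) = -ι K v := CliffordAlgebra.involute_ι v
    rw [h, neg_mul, eq_neg_iff_add_eq_zero, ι_add_mul_swap]
  | mul x y hx hy => rw [map_mul, ← mul_assoc, hx, mul_assoc, hy, mul_assoc]
  | add x y hx hy => rw [map_add, mul_add, add_mul, hx, hy]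

theorem mul_ι_eq_ι_mul_involute (a : V) (s : ExteriorAlgebra K V) :
    s * ι K a = ι K a * CliffordAlgebra.involute s := by
  rw [ι_mul_eq_involute_mul, CliffordAlgebra.involute_involute]

theorem ι_mem_vectorIdeal {A : Set V} {a : V} (ha : a ∈ Submodule.span K A) :
    ι K a ∈ vectorIdeal K A := by
  induction ha using Submodule.span_induction with
  | mem x hx => exact TwoSidedIdeal.subset_span ⟨x, hx, rfl⟩
  | zero => rw [map_zero]; exact zero_mem _
  | add x y _ _ hx hy => rw [map_add]; exact add_mem hx hy
  | smul c x _ hx =>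
    rw [map_smul, Algebra.smul_def]
    exact TwoSidedIdeal.mul_mem_left _ _ _ hx

theorem vectorIdeal_mono {A B : Set V} (h : A ⊆ Submodule.span K B) :
    vectorIdeal K A ≤ vectorIdeal K B := by
  refine TwoSidedIdeal.span_le.2 ?_
  rintro _ ⟨a, ha, rfl⟩
  exact ι_mem_vectorIdeal (h ha)

theorem squareIdeal_mono {A B : Set V} (h : A ⊆ Submodule.span K B) :
    squareIdeal K A ≤ squareIdeal K B := by
  refine TwoSidedIdeal.span_mono ?_
  rintro _ ⟨x, hx, y, hy, rfl⟩
  exact ⟨x, vectorIdeal_mono h hx, y, vectorIdeal_mono h hy, rfl⟩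

theorem squareIdeal_congr {A B : Set V} (h : A ⊆ Submodule.span K B)
    (h' : B ⊆ Submodule.span K A) : squareIdeal K A = squareIdeal K B :=
  le_antisymm (squareIdeal_mono h) (squareIdeal_mono h')

theorem ι_mul_ι_mem_squareIdeal {A : Set V} {a b : V} (ha : a ∈ Submodule.span K A)
    (hb : b ∈ Submodule.span K A) : ι K a * ι K b ∈ squareIdeal K A :=
  TwoSidedIdeal.subset_span ⟨_, ι_mem_vectorIdeal ha, _, ι_mem_vectorIdeal hb, rfl⟩

theorem ι_mul_ι_mul_self (a b : V) (x : ExteriorAlgebra K V) :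
    ι K a * (ι K b * (ι K a * x)) = 0 := by
  rw [← mul_assoc (ι K b), eq_neg_of_add_eq_zero_left (ι_add_mul_swap b a), neg_mul, mul_neg,
    ← mul_assoc, ← mul_assoc, ι_sq_zero, zero_mul, zero_mul, neg_zero]

/-- An element of the square of the ideal generated by three vectors is annihilated by the product
of two of them: the product of four vectors in a three-dimensional space vanishes. -/
theorem mul_ι_mul_ι_eq_zero {a b c : V} {x : ExteriorAlgebra K V}
    (hx : x ∈ squareIdeal K {a, b, c}) : x * ι K a * ι K b = 0 := by
  have pair : ∀ s : ExteriorAlgebra K V, s * (ι K a * ι K b) = ι K a * ι K b * s := by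
    intro s
    rw [← mul_assoc, mul_ι_eq_ι_mul_involute a s, mul_assoc (ι K a),
      mul_ι_eq_ι_mul_involute b (CliffordAlgebra.involute s),
      CliffordAlgebra.involute_involute, mul_assoc]
  have triple : ∀ s : ExteriorAlgebra K V, s * (ι K c * (ι K a * ι K b)) =
      ι K c * (ι K a * ι K b) * CliffordAlgebra.involute s := by
    intro s
    rw [← mul_assoc, mul_ι_eq_ι_mul_involute c s, mul_assoc, pair, ← mul_assoc]
  -- modulo `a ∧ b` only the generator `c` survives, and a second factor from the ideal kills
  -- `c ∧ a ∧ b`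
  have h1 : ∀ y ∈ vectorIdeal K {a, b, c}, ∃ z, y * (ι K a * ι K b) =
      z * (ι K c * (ι K a * ι K b)) := by
    intro y hy
    induction hy using TwoSidedIdeal.span_induction with
    | mem y hy =>
      obtain ⟨v, rfl | rfl | rfl, rfl⟩ := hy
      · exact ⟨0, by rw [← mul_assoc, ι_sq_zero, zero_mul, zero_mul]⟩
      · refine ⟨0, ?_⟩
        have := ι_mul_ι_mul_self (K := K) v a 1
        rw [mul_one] at this
        rw [this, zero_mul]
      · exact ⟨1, by rw [one_mul]⟩
    | zero => exact ⟨0, by simp⟩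
    | add x y _ _ hx hy =>
      obtain ⟨z, hz⟩ := hx
      obtain ⟨z', hz'⟩ := hy
      exact ⟨z + z', by rw [add_mul, hz, hz', add_mul]⟩
    | neg x _ hx =>
      obtain ⟨z, hz⟩ := hx
      exact ⟨-z, by rw [neg_mul, hz, neg_mul]⟩
    | left_absorb s x _ hx =>
      obtain ⟨z, hz⟩ := hx
      exact ⟨s * z, by rw [mul_assoc, hz, mul_assoc]⟩
    | right_absorb s x _ hx =>
      obtain ⟨z, hz⟩ := hx
      refine ⟨z * CliffordAlgebra.involute s, ?_⟩
      rw [mul_assoc, pair, ← mul_assoc, hz, mul_assoc, mul_assoc z, triple,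
        CliffordAlgebra.involute_involute]
  have h2 : ∀ y ∈ vectorIdeal K {a, b, c}, y * (ι K c * (ι K a * ι K b)) = 0 := by
    intro y hy
    induction hy using TwoSidedIdeal.span_induction with
    | mem y hy =>
      obtain ⟨v, rfl | rfl | rfl, rfl⟩ := hy
      · rw [ι_mul_ι_mul_self]
      · rw [pair, mul_assoc (ι K a), ι_mul_ι_mul_self]
      · rw [← mul_assoc, ι_sq_zero, zero_mul]
    | zero => rw [zero_mul]
    | add x y _ _ hx hy => rw [add_mul, hx, hy, add_zero]
    | neg x _ hx => rw [neg_mul, hx, neg_zero]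
    | left_absorb s x _ hx => rw [mul_assoc, hx, mul_zero]
    | right_absorb s x _ hx => rw [mul_assoc, triple, ← mul_assoc, hx, zero_mul]
  rw [mul_assoc]
  induction hx using TwoSidedIdeal.span_induction with
  | mem y hy =>
    obtain ⟨y, hy, y', hy', rfl⟩ := hy
    obtain ⟨z, hz⟩ := h1 y' hy'
    rw [mul_assoc, hz, ← mul_assoc, h2 _ (TwoSidedIdeal.mul_mem_right _ _ _ hy)]
  | zero => rw [zero_mul]
  | add x y _ _ hx hy => rw [add_mul, hx, hy, add_zero]
  | neg x _ hx => rw [neg_mul, hx, neg_zero]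
  | left_absorb s x _ hx => rw [mul_assoc, hx, mul_zero]
  | right_absorb s x _ hx => rw [mul_assoc, pair, ← mul_assoc, hx, zero_mul]

theorem wedgeForm_three_apply {n : ℕ} (e : Module.Basis (Fin n) K V) (z : ExteriorAlgebra K V)
    (a b c : V) : wedgeForm e 3 z ![a, b, c] = topForm e (z * ι K a * ι K b * ι K c) := by
  simp [ιMulti_apply, mul_assoc]

theorem wedgeForm_eq_zero_of_mem_squareIdeal {n : ℕ} (e : Module.Basis (Fin n) K V) {a b c : V}
    {z : ExteriorAlgebra K V} (hz : z ∈ squareIdeal K {a, b, c}) (x : V) :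
    wedgeForm e 3 z ![a, b, x] = 0 := by
  rw [wedgeForm_three_apply, mul_ι_mul_ι_eq_zero hz, zero_mul, map_zero]

end Ideals

/-! ### The space `Z` -/

section Z

variable {K V : Type*} [Field K] [AddCommGroup V] [Module K V]

open ExteriorAlgebra

theorem mem_Z {e : Module.Basis (Fin 7) K V} {v w : V} {z : ExteriorAlgebra K V} :
    z ∈ Z K e v w ↔ z ∈ ⋀[K]^4 V ∧ z ∈ squareIdeal K {e 0, e 1, e 2} ∧
      z ∈ squareIdeal K {e 3, e 4, e 5} ∧ z ∈ squareIdeal K {e 6, v, w} := by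
  change (_ ∧ ∀ j : Fin 3, _) ↔ _
  simp [Fin.forall_fin_succ]

theorem Z_congr {e e' : Module.Basis (Fin 7) K V} {v w : V}
    (h : squareIdeal K {e 0, e 1, e 2} = squareIdeal K {e' 0, e' 1, e' 2})
    (h' : squareIdeal K {e 3, e 4, e 5} = squareIdeal K {e' 3, e' 4, e' 5})
    (h6 : e 6 = e' 6) : Z K e v w = Z K e' v w := by
  ext z
  rw [mem_Z, mem_Z, h, h', h6]

theorem ι_mul_four_mem (a b c d : V) : ι K a * ι K b * ι K c * ι K d ∈ ⋀[K]^4 V := by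
  have := (exteriorPower.ιMulti K 4 ![a, b, c, d]).2
  simpa [ιMulti_apply, mul_assoc] using this

/-- In an adapted basis, with `v` and `w` congruent to `e₀ + e₃` and `e₁ + e₄` modulo `e₆`, the
space `Z` is spanned by `e₀ ∧ e₁ ∧ e₃ ∧ e₄`. -/
theorem finrank_Z_of_adapted (e : Module.Basis (Fin 7) K V) {v w : V} {α β : K}
    (hv : v = e 0 + e 3 + α • e 6) (hw : w = e 1 + e 4 + β • e 6) :
    Module.finrank K (Z K e v w) = 1 := by
  -- `Z` injects into the scalars
  have hdet : ∀ z ∈ Z K e v w, wedgeForm e 3 z ![e 2, e 5, e 6] = 0 → z = 0 := by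
    intro z hz h0
    obtain ⟨h4, hA, hB, hC⟩ := mem_Z.1 hz
    refine eq_zero_of_wedgeForm_eq_zero (by norm_num) e h4
      (alternating_eq_zero_of_tangent e hv hw _ ?_ ?_ ?_ ?_ ?_ ?_ ?_ ?_ h0)
    · exact wedgeForm_eq_zero_of_mem_squareIdeal e hA
    · exact wedgeForm_eq_zero_of_mem_squareIdeal (c := e 1) e (by rwa [Set.pair_comm (e 2)])
    · refine wedgeForm_eq_zero_of_mem_squareIdeal (c := e 0) e ?_
      rwa [Set.pair_comm (e 2), Set.insert_comm (e 1)]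
    · exact wedgeForm_eq_zero_of_mem_squareIdeal e hB
    · exact wedgeForm_eq_zero_of_mem_squareIdeal (c := e 4) e (by rwa [Set.pair_comm (e 5)])
    · refine wedgeForm_eq_zero_of_mem_squareIdeal (c := e 3) e ?_
      rwa [Set.pair_comm (e 5), Set.insert_comm (e 4)]
    · exact wedgeForm_eq_zero_of_mem_squareIdeal e hC
    · exact wedgeForm_eq_zero_of_mem_squareIdeal (c := v) e (by rwa [Set.pair_comm w])
  let ζ : ExteriorAlgebra K V := ι K (e 0) * ι K (e 1) * ι K (e 3) * ι K (e 4)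
  have hζ : ζ ∈ Z K e v w := by
    refine mem_Z.2 ⟨ι_mul_four_mem _ _ _ _, ?_, ?_, ?_⟩
    · refine TwoSidedIdeal.mul_mem_right _ _ _ (TwoSidedIdeal.mul_mem_right _ _ _
        (ι_mul_ι_mem_squareIdeal (Submodule.subset_span ?_) (Submodule.subset_span ?_))) <;> simp
    · rw [show ζ = _ from mul_assoc _ _ _]
      refine TwoSidedIdeal.mul_mem_left _ _ _
        (ι_mul_ι_mem_squareIdeal (Submodule.subset_span ?_) (Submodule.subset_span ?_)) <;> simp
    · have h : ζ = ι K (e 0 + e 3) * ι K (e 1 + e 4) * (ι K (e 3) * ι K (e 4)) := by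
        have h1 : ι K (e 4) * (ι K (e 3) * ι K (e 4)) = 0 := by
          have := ι_mul_ι_mul_self (K := K) (e 4) (e 3) 1
          rwa [mul_one] at this
        simp only [ζ, map_add, add_mul, mul_add, mul_assoc, h1, mul_zero, add_zero,
          ι_mul_ι_mul_self]
      rw [h]
      refine TwoSidedIdeal.mul_mem_right _ _ _ (ι_mul_ι_mem_squareIdeal ?_ ?_)
      · rw [show e 0 + e 3 = v - α • e 6 by rw [hv, add_sub_cancel_right]]
        exact sub_mem (Submodule.subset_span (by simp))
          (Submodule.smul_mem _ _ (Submodule.subset_span (by simp)))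
      · rw [show e 1 + e 4 = w - β • e 6 by rw [hw, add_sub_cancel_right]]
        exact sub_mem (Submodule.subset_span (by simp))
          (Submodule.smul_mem _ _ (Submodule.subset_span (by simp)))
  have hζ0 : wedgeForm e 3 ζ ![e 2, e 5, e 6] ≠ 0 := by
    have h1 : ζ * ιMulti K 3 ![e 2, e 5, e 6] = ιMulti K 7 (e ∘ ![0, 1, 3, 4, 2, 5, 6]) := by
      rw [show e ∘ ![0, 1, 3, 4, 2, 5, 6] = ![e 0, e 1, e 3, e 4, e 2, e 5, e 6] by
        ext1 i; fin_cases i <;> rfl]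
      simp [ζ, ιMulti_apply, mul_assoc]
    rw [wedgeForm_apply, h1, topForm_ιMulti]
    exact det_comp_of_injective e (by decide)
  have hne : (⟨ζ, hζ⟩ : Z K e v w) ≠ 0 := by
    intro h
    have : ζ = 0 := congrArg Subtype.val h
    exact hζ0 (by rw [this]; simp)
  rw [finrank_eq_one_iff_of_nonzero' _ hne]
  rintro ⟨z, hz⟩
  refine ⟨wedgeForm e 3 z ![e 2, e 5, e 6] / wedgeForm e 3 ζ ![e 2, e 5, e 6], ?_⟩
  have h1 : wedgeForm e 3 ((wedgeForm e 3 z ![e 2, e 5, e 6] / wedgeForm e 3 ζ ![e 2, e 5, e 6]) • ζ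
      - z) ![e 2, e 5, e 6] = 0 := by
    rw [wedgeForm_apply, sub_mul, smul_mul_assoc, map_sub, map_smul, smul_eq_mul,
      ← wedgeForm_apply, ← wedgeForm_apply, div_mul_cancel₀ _ hζ0, sub_self]
  exact Subtype.ext (sub_eq_zero.1 (hdet _ (sub_mem (Submodule.smul_mem _ _ hζ) hz) h1))

/-- Two vectors of `⟨e₀, e₁, e₂⟩` that are independent modulo `e₂` span it together with `e₂`. -/
theorem span_triple_eq {a b c x y z : K} {e₀ e₁ e₂ : V} (h : a * y - b * x ≠ 0) :
    ({a • e₀ + b • e₁ + c • e₂, x • e₀ + y • e₁ + z • e₂, e₂} : Set V) ⊆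
        Submodule.span K {e₀, e₁, e₂} ∧
      ({e₀, e₁, e₂} : Set V) ⊆ Submodule.span K
        {a • e₀ + b • e₁ + c • e₂, x • e₀ + y • e₁ + z • e₂, e₂} := by
  have lin : ∀ (u₁ u₂ u₃ : V) (r s t : K), r • u₁ + s • u₂ + t • u₃ ∈
      Submodule.span K ({u₁, u₂, u₃} : Set V) := fun u₁ u₂ u₃ r s t =>
    add_mem (add_mem (Submodule.smul_mem _ _ (Submodule.subset_span (by simp)))
      (Submodule.smul_mem _ _ (Submodule.subset_span (by simp))))
      (Submodule.smul_mem _ _ (Submodule.subset_span (by simp)))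
  constructor
  · rintro _ (rfl | rfl | rfl)
    exacts [lin _ _ _ _ _ _, lin _ _ _ _ _ _, Submodule.subset_span (by simp)]
  · obtain ⟨d, hd⟩ : ∃ d, d * (a * y - b * x) = 1 := ⟨_, inv_mul_cancel₀ h⟩
    rintro u (rfl | rfl | rfl)
    · rw [SetLike.mem_coe]
      convert lin _ _ _ (y * d) (-b * d) ((b * z - c * y) * d) using 1
      match_scalars
      · linear_combination -hd
      · ring
      · ring
    · rw [SetLike.mem_coe]
      convert lin _ _ _ (-x * d) (a * d) ((c * x - a * z) * d) using 1
      match_scalars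
      · linear_combination -hd
      · ring
      · ring
    · exact Submodule.subset_span (by simp)

/-- The space `Z` is a line as soon as the components of `v`, `w` in `⟨e₀, e₁, e₂⟩` and those in
`⟨e₃, e₄, e₅⟩` are independent, here witnessed by one minor each. -/
theorem finrank_Z_eq_one (e : Module.Basis (Fin 7) K V) {x y : Fin 7 → K}
    (hA : x 0 * y 1 - x 1 * y 0 ≠ 0) (hB : x 3 * y 4 - x 4 * y 3 ≠ 0) :
    Module.finrank K (Z K e (∑ i, x i • e i) (∑ i, y i • e i)) = 1 := by
  -- the adapted basis: the components of `v` and `w` replace `e₀, e₁` and `e₃, e₄`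
  let u : Fin 7 → V := ![x 0 • e 0 + x 1 • e 1 + x 2 • e 2, y 0 • e 0 + y 1 • e 1 + y 2 • e 2,
    e 2, x 3 • e 3 + x 4 • e 4 + x 5 • e 5, y 3 • e 3 + y 4 • e 4 + y 5 • e 5, e 5, e 6]
  obtain ⟨hA1, hA2⟩ := span_triple_eq (c := x 2) (z := y 2) (e₀ := e 0) (e₁ := e 1) (e₂ := e 2) hA
  obtain ⟨hB1, hB2⟩ := span_triple_eq (c := x 5) (z := y 5) (e₀ := e 3) (e₁ := e 4) (e₂ := e 5) hB
  have htop : ⊤ ≤ Submodule.span K (Set.range u) := by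
    have sA : ({u 0, u 1, u 2} : Set V) ⊆ Set.range u := by
      rintro _ (rfl | rfl | rfl) <;> exact ⟨_, rfl⟩
    have sB : ({u 3, u 4, u 5} : Set V) ⊆ Set.range u := by
      rintro _ (rfl | rfl | rfl) <;> exact ⟨_, rfl⟩
    rw [← e.span_eq, Submodule.span_le]
    rintro _ ⟨i, rfl⟩
    fin_cases i
    · exact Submodule.span_mono sA (hA2 (by simp))
    · exact Submodule.span_mono sA (hA2 (by simp))
    · exact Submodule.span_mono sA (hA2 (by simp))
    · exact Submodule.span_mono sB (hB2 (by simp))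
    · exact Submodule.span_mono sB (hB2 (by simp))
    · exact Submodule.span_mono sB (hB2 (by simp))
    · exact Submodule.subset_span ⟨6, rfl⟩
  let e' : Module.Basis (Fin 7) K V := basisOfTopLeSpanOfCardEqFinrank u htop
    (Module.finrank_eq_card_basis e).symm
  have he' : ∀ i, e' i = u i := fun i => by simp [e']
  have hZ : ∀ v w, Z K e v w = Z K e' v w := fun v w => by
    refine Z_congr ?_ ?_ ?_
    · rw [he', he', he']; exact squareIdeal_congr hA2 hA1
    · rw [he', he', he']; exact squareIdeal_congr hB2 hB1
    · rw [he']; rfl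
  rw [hZ]
  refine finrank_Z_of_adapted e' (α := x 6) (β := y 6) ?_ ?_
  · simp only [he', u, Fin.sum_univ_seven]
    simp [add_assoc]
  · simp only [he', u, Fin.sum_univ_seven]
    simp [add_assoc]

end Z

/-! ### The linear system for `v ∧ w ∧ Γ` -/

section LinearSystem

variable {K V : Type*} [Field K] [AddCommGroup V] [Module K V]

open ExteriorAlgebra

theorem ιMulti_four_mem_squareIdeal {A : Set V} {v : Fin 4 → V} {a b : Fin 4} (hab : a ≠ b)
    (ha : v a ∈ A) (hb : v b ∈ A) : ιMulti K 4 v ∈ squareIdeal K A := by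
  obtain ⟨σ, h0, h1⟩ : ∃ σ : Equiv.Perm (Fin 4), σ 0 = a ∧ σ 1 = b :=
    (by decide : ∀ a b : Fin 4, a ≠ b → ∃ σ : Equiv.Perm (Fin 4), σ 0 = a ∧ σ 1 = b) a b hab
  have hmem : ιMulti K 4 (v ∘ σ) ∈ squareIdeal K A := by
    have : ιMulti K 4 (v ∘ σ) = ι K (v a) * ι K (v b) * (ι K (v (σ 2)) * ι K (v (σ 3))) := by
      rw [show v ∘ σ = ![v a, v b, v (σ 2), v (σ 3)] by
        rw [← h0, ← h1]; ext1 i; fin_cases i <;> rfl]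
      simp [ιMulti_apply, mul_assoc]
    rw [this]
    exact TwoSidedIdeal.mul_mem_right _ _ _
      (ι_mul_ι_mem_squareIdeal (Submodule.subset_span ha) (Submodule.subset_span hb))
  have h := (ιMulti K 4).map_perm v σ
  rcases Int.units_eq_one_or (Equiv.Perm.sign σ) with hs | hs
  · rw [hs, one_smul] at h
    rwa [← h]
  · rw [hs, Units.neg_smul, one_smul] at h
    rw [← neg_neg (ιMulti K 4 v), ← h]
    exact neg_mem hmem

/-- The degree `4` part of the square of the ideal of a coordinate plane is cut out by the
annihilation conditions: a coordinate of `z` at an index set with at most one element in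
`{i, j, k}` is read off by a wedge product with two of the vectors `eᵢ, eⱼ, eₖ`. -/
theorem mem_squareIdeal_of_wedgeForm_eq_zero (e : Module.Basis (Fin 7) K V)
    {z : ExteriorAlgebra K V} (hz : z ∈ ⋀[K]^4 V) {i j k : Fin 7} (hij : i ≠ j) (hik : i ≠ k)
    (hjk : j ≠ k) (h1 : ∀ x, wedgeForm e 3 z ![e i, e j, x] = 0)
    (h2 : ∀ x, wedgeForm e 3 z ![e i, e k, x] = 0)
    (h3 : ∀ x, wedgeForm e 3 z ![e j, e k, x] = 0) : z ∈ squareIdeal K {e i, e j, e k} := by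
  -- coordinates that are zero
  have hout : ∀ (S : Set.powersetCard (Fin 7) 4) (a b : Fin 7), a ≠ b → a ∉ S → b ∉ S →
      (∀ x, wedgeForm e 3 z ![e a, e b, x] = 0) → (e.exteriorPower 4).repr ⟨z, hz⟩ S = 0 := by
    intro S a b hab ha hb h
    obtain ⟨f, hf, u, hu, hfz⟩ := exists_topForm_mul_eq (q := 3) (by norm_num) e S
    obtain ⟨a', ha'⟩ := (hf a).2 ha
    obtain ⟨b', hb'⟩ := (hf b).2 hb
    have hne : a' ≠ b' := fun h => hab (by rw [← ha', ← hb', h])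
    obtain ⟨c', hc'⟩ : ∃ c' : Fin 3, ∀ l, l = a' ∨ l = b' ∨ l = c' := by
      clear ha' hb'; decide +revert
    have key : wedgeForm e 3 z (fun l => e (f l)) = 0 := by
      refine map_eq_zero_of_range _ e (g := ![a, b, f c']) (fun l => ?_) ?_
      · rcases hc' l with rfl | rfl | rfl
        exacts [⟨0, ha'⟩, ⟨1, hb'⟩, ⟨2, rfl⟩]
      · rw [← h (e (f c'))]
        congr 1
        ext1 l; fin_cases l <;> rfl
    have := hfz ⟨z, hz⟩
    rw [← wedgeForm_apply] at this
    change wedgeForm e 3 z (fun l => e (f l)) = _ at this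
    rw [key] at this
    exact (mul_eq_zero.1 this.symm).resolve_left hu
  -- basis vectors that lie in the square of the ideal
  have hin : ∀ (S : Set.powersetCard (Fin 7) 4) (a b : Fin 7), a ≠ b → a ∈ S → b ∈ S →
      e a ∈ ({e i, e j, e k} : Set V) → e b ∈ ({e i, e j, e k} : Set V) →
      (e.exteriorPower 4 S : ExteriorAlgebra K V) ∈ squareIdeal K {e i, e j, e k} := by
    intro S a b hab ha hb hea heb
    obtain ⟨a', rfl⟩ := (Set.powersetCard.mem_range_ofFinEmbEquiv_symm_iff_mem S a).2 ha
    obtain ⟨b', rfl⟩ := (Set.powersetCard.mem_range_ofFinEmbEquiv_symm_iff_mem S b).2 hb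
    rw [exteriorPower.basis_apply]
    exact ιMulti_four_mem_squareIdeal (a := a') (b := b') (fun h => hab (by rw [h])) hea heb
  have hle : Submodule.span K (e.exteriorPower 4 '' ((e.exteriorPower 4).repr ⟨z, hz⟩).support) ≤
      (squaresPiece K 4 (fun _ : Fin 1 => {e i, e j, e k})).comap (⋀[K]^4 V).subtype := by
    rw [Submodule.span_le]
    rintro _ ⟨S, hS, rfl⟩
    refine ⟨Submodule.coe_mem _, fun _ => ?_⟩
    have hS' : (e.exteriorPower 4).repr ⟨z, hz⟩ S ≠ 0 := by simpa using hS
    by_cases hi : i ∈ S <;> by_cases hj : j ∈ S <;> by_cases hk : k ∈ S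
    · exact hin S i j hij hi hj (by simp) (by simp)
    · exact hin S i j hij hi hj (by simp) (by simp)
    · exact hin S i k hik hi hk (by simp) (by simp)
    · exact absurd (hout S j k hjk hj hk h3) hS'
    · exact hin S j k hjk hj hk (by simp) (by simp)
    · exact absurd (hout S i k hik hi hk h2) hS'
    · exact absurd (hout S i j hij hi hj h1) hS'
    · exact absurd (hout S i j hij hi hj h1) hS'
  exact (hle ((e.exteriorPower 4).mem_span_repr_support ⟨z, hz⟩)).2 0

/-- The top coefficient vanishes on the exterior algebra of a hyperplane. -/
theorem topForm_map_eq_zero {n : ℕ} (e : Module.Basis (Fin n) K V) {π : V →ₗ[K] V} {k : Fin n}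
    (h : ∀ x, e.coord k (π x) = 0) (y : ExteriorAlgebra K V) : topForm e (map π y) = 0 := by
  suffices topForm e ∘ₗ (map π).toLinearMap = 0 from LinearMap.congr_fun this y
  refine lhom_ext fun i => ?_
  ext v
  by_cases hi : i = n
  · subst hi
    have : e.det (π ∘ v) = 0 := by
      rw [Module.Basis.det_apply]
      exact Matrix.det_eq_zero_of_row_eq_zero k fun j => by
        simpa [Module.Basis.toMatrix_apply] using h (v j)
    simpa [map_apply_ιMulti, topForm_ιMulti] using this
  · simp [map_apply_ιMulti, topForm, liftAlternating_apply_ιMulti, Pi.single_eq_of_ne hi]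

/-- If `z` does not involve `e₆`, then `z ∧ e_a ∧ e_b` vanishes as soon as `z ∧ e_a ∧ e_b ∧ e₆`
does. That `z` does not involve `e₆` is expressed by a projection `π` along `e₆` that fixes `z`. -/
theorem wedgeForm_eq_zero_of_last (e : Module.Basis (Fin 7) K V) {π : V →ₗ[K] V}
    (hπ : ∀ i : Fin 6, π (e i.castSucc) = e i.castSucc) (hπ' : π (e 6) = 0)
    {z : ExteriorAlgebra K V} (hz : map π z = z) (a b : Fin 6)
    (h : wedgeForm e 3 z ![e a.castSucc, e b.castSucc, e 6] = 0) (x : V) :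
    wedgeForm e 3 z ![e a.castSucc, e b.castSucc, x] = 0 := by
  have hcoord : ∀ x, e.coord 6 (π x) = 0 := by
    intro x
    have : e.coord 6 ∘ₗ π = 0 := by
      refine e.ext fun i => ?_
      refine Fin.lastCases ?_ (fun i => ?_) i
      · simp [show Fin.last 6 = 6 from rfl, hπ']
      · have : i.castSucc ≠ 6 := (Fin.castSucc_lt_last i).ne
        simp [hπ, this]
    exact LinearMap.congr_fun this x
  simp only [wedgeForm_three_apply] at h ⊢
  let ℓ : V →ₗ[K] K := topForm e ∘ₗ LinearMap.mulLeft K (z * ι K (e a.castSucc) *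
    ι K (e b.castSucc)) ∘ₗ ι K
  suffices ℓ = 0 from LinearMap.congr_fun this x
  refine e.ext fun i => ?_
  refine Fin.lastCases ?_ (fun i => ?_) i
  · exact h
  · have h1 : map π (z * ι K (e a.castSucc) * ι K (e b.castSucc) * ι K (e i.castSucc)) =
        z * ι K (e a.castSucc) * ι K (e b.castSucc) * ι K (e i.castSucc) := by
      simp [hz, hπ]
    change topForm e (z * ι K (e a.castSucc) * ι K (e b.castSucc) * ι K (e i.castSucc)) = 0
    rw [← h1, topForm_map_eq_zero e hcoord]

/-- The pairs of basis vectors from `⟨e₀, e₁, e₂⟩` or `⟨e₃, e₄, e₅⟩` that produce the rows of the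
linear system, ordered so that all signs are positive. -/
def rowPair : Fin 6 → Fin 6 × Fin 6 := ![(4, 5), (5, 3), (3, 4), (1, 2), (2, 0), (0, 1)]

/-- The basis of bivectors in `e₁, …, e₄` in which `Γ` is written. -/
def colPair : Fin 6 → Fin 6 × Fin 6 := ![(1, 2), (1, 3), (1, 4), (2, 3), (2, 4), (3, 4)]

/-- The entries of the coefficient matrix are differences `b_p - b_q`; this is the pair
`(p, q)`. -/
def entryPair : Fin 6 → Fin 6 → Fin 6 × Fin 6 :=
  ![![(3, 0), (0, 2), (0, 0), (1, 0), (0, 0), (0, 0)],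
    ![(4, 0), (0, 0), (0, 2), (0, 0), (1, 0), (0, 0)],
    ![(5, 0), (0, 0), (0, 0), (0, 0), (0, 0), (0, 0)],
    ![(0, 0), (0, 0), (0, 0), (0, 0), (0, 0), (5, 0)],
    ![(0, 0), (5, 4), (3, 5), (0, 0), (0, 0), (5, 1)],
    ![(0, 0), (0, 0), (0, 0), (5, 4), (3, 5), (5, 2)]]

theorem coeffMatrix_apply (b : Fin 6 → K) (r k : Fin 6) :
    coeffMatrix b r k = b (entryPair r k).1 - b (entryPair r k).2 := by
  fin_cases r <;> fin_cases k <;> simp [coeffMatrix, entryPair]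

set_option maxRecDepth 100000 in
/-- The coefficient of `b_q c_k` in row `r` of the system: the signs of the seven basis vectors in
`e_p ∧ e_q ∧ Γ ∧ e_a ∧ e_b ∧ e₆`, summed over the terms `e_p` of `v`. -/
theorem sum_tupleSign : ∀ r k q : Fin 6,
    ∑ p : Fin 6, tupleSign ![p.castSucc, q.castSucc, (colPair k).1.castSucc,
      (colPair k).2.castSucc, (rowPair r).1.castSucc, (rowPair r).2.castSucc, (6 : Fin 7)] =
    (if q = (entryPair r k).1 then 1 else 0) - (if q = (entryPair r k).2 then 1 else 0) := by
  decide +kernel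

theorem bivector_eq (e : Module.Basis (Fin 7) K V) (c : Fin 6 → K) :
    bivector K e c = ∑ k, c k • (ι K (e (colPair k).1.castSucc) *
      ι K (e (colPair k).2.castSucc)) := by
  simp [bivector, Fin.sum_univ_six, colPair]

/-- The rows of the linear system are the coefficients of `v ∧ w ∧ Γ` that have to vanish. -/
theorem wedgeForm_eq_mulVec (e : Module.Basis (Fin 7) K V) (b c : Fin 6 → K) (r : Fin 6) :
    wedgeForm e 3 (ι K (∑ i : Fin 6, e i.castSucc) * ι K (∑ i : Fin 6, b i • e i.castSucc) *
      bivector K e c) ![e (rowPair r).1.castSucc, e (rowPair r).2.castSucc, e 6] =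
    (coeffMatrix b).mulVec c r := by
  have h7 : ∀ i₀ i₁ i₂ i₃ i₄ i₅ i₆ : Fin 7, topForm e (ι K (e i₀) * ι K (e i₁) *
      (ι K (e i₂) * ι K (e i₃)) * ι K (e i₄) * ι K (e i₅) * ι K (e i₆)) =
      (tupleSign ![i₀, i₁, i₂, i₃, i₄, i₅, i₆] : K) := by
    intro i₀ i₁ i₂ i₃ i₄ i₅ i₆
    rw [← det_comp_eq_tupleSign e, ← topForm_ιMulti]
    congr 1
    rw [show e ∘ ![i₀, i₁, i₂, i₃, i₄, i₅, i₆] = ![e i₀, e i₁, e i₂, e i₃, e i₄, e i₅, e i₆] by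
        ext1 i; fin_cases i <;> rfl]
    simp [ιMulti_apply, mul_assoc]
  rw [wedgeForm_three_apply, bivector_eq, map_sum, map_sum]
  simp only [map_smul, Finset.mul_sum, Finset.sum_mul, mul_smul_comm, smul_mul_assoc, map_sum,
    h7, smul_eq_mul]
  rw [Matrix.mulVec, dotProduct]
  refine Finset.sum_congr rfl fun k _ => ?_
  have h := fun q => congrArg (Int.cast : ℤ → K) (sum_tupleSign r k q)
  simp only [Int.cast_sum] at h
  have h' : ∑ q, b q * ∑ p : Fin 6, (tupleSign ![p.castSucc, q.castSucc, (colPair k).1.castSucc,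
      (colPair k).2.castSucc, (rowPair r).1.castSucc, (rowPair r).2.castSucc, (6 : Fin 7)] : K) =
      coeffMatrix b r k := by
    simp only [h, coeffMatrix_apply]
    simp [mul_sub]
  rw [← h', mul_comm]
  simp only [Finset.mul_sum]

theorem mem_Z_iff_mulVec_eq_zero (e : Module.Basis (Fin 7) K V) (b c : Fin 6 → K) :
    ι K (∑ i : Fin 6, e i.castSucc) * ι K (∑ i : Fin 6, b i • e i.castSucc) * bivector K e c ∈
      Z K e (∑ i : Fin 6, e i.castSucc) (∑ i : Fin 6, b i • e i.castSucc) ↔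
    (coeffMatrix b).mulVec c = 0 := by
  have row := wedgeForm_eq_mulVec e b c
  generalize hz : ι K (∑ i : Fin 6, e i.castSucc) * ι K (∑ i : Fin 6, b i • e i.castSucc) *
    bivector K e c = z at row ⊢
  have swap : ∀ p q x : V, wedgeForm e 3 z ![p, q, x] = 0 → wedgeForm e 3 z ![q, p, x] = 0 := by
    intro p q x h
    rw [wedgeForm_three_apply] at h ⊢
    rw [mul_assoc z, eq_neg_of_add_eq_zero_left (ι_add_mul_swap q p), mul_neg, neg_mul, map_neg,
      ← mul_assoc z, h, neg_zero]
  have h4 : z ∈ ⋀[K]^4 V := by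
    rw [← hz, bivector_eq, Finset.mul_sum]
    refine sum_mem fun k _ => ?_
    rw [mul_smul_comm, ← mul_assoc]
    exact Submodule.smul_mem _ _ (ι_mul_four_mem _ _ _ _)
  constructor
  · intro h
    obtain ⟨-, hA, hB, -⟩ := mem_Z.1 h
    have hA' := fun x => wedgeForm_eq_zero_of_mem_squareIdeal e hA x
    rw [Set.insert_comm, Set.pair_comm] at hA
    have hA'' := fun x => wedgeForm_eq_zero_of_mem_squareIdeal e hA x
    rw [Set.insert_comm, Set.pair_comm] at hA
    have hA''' := fun x => wedgeForm_eq_zero_of_mem_squareIdeal e hA x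
    have hB' := fun x => wedgeForm_eq_zero_of_mem_squareIdeal e hB x
    rw [Set.insert_comm, Set.pair_comm] at hB
    have hB'' := fun x => wedgeForm_eq_zero_of_mem_squareIdeal e hB x
    rw [Set.insert_comm, Set.pair_comm] at hB
    have hB''' := fun x => wedgeForm_eq_zero_of_mem_squareIdeal e hB x
    funext r
    rw [← row r]
    fin_cases r
    exacts [hB'' _, hB''' _, hB' _, hA'' _, hA''' _, hA' _]
  · intro h
    let π : V →ₗ[K] V := e.constr K (Function.update e 6 0)
    have hπ : ∀ i : Fin 6, π (e i.castSucc) = e i.castSucc := fun i => by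
      have : i.castSucc ≠ 6 := (Fin.castSucc_lt_last i).ne
      simp [π, this]
    have hπ' : π (e 6) = 0 := by simp [π]
    have hmap : map π z = z := by
      rw [← hz, bivector_eq]
      simp [hπ]
    have key : ∀ r : Fin 6, ∀ x, wedgeForm e 3 z
        ![e (rowPair r).1.castSucc, e (rowPair r).2.castSucc, x] = 0 := fun r x =>
      wedgeForm_eq_zero_of_last e hπ hπ' hmap _ _ (by rw [row, h]; rfl) x
    refine mem_Z.2 ⟨h4, ?_, ?_, ?_⟩
    · exact mem_squareIdeal_of_wedgeForm_eq_zero e h4 (by decide) (by decide) (by decide)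
        (key 5) (fun x => swap _ _ _ (key 4 x)) (key 3)
    · exact mem_squareIdeal_of_wedgeForm_eq_zero e h4 (by decide) (by decide) (by decide)
        (key 2) (fun x => swap _ _ _ (key 1 x)) (key 0)
    · rw [← hz]
      exact TwoSidedIdeal.mul_mem_right _ _ _ (ι_mul_ι_mem_squareIdeal
        (Submodule.subset_span (by simp)) (Submodule.subset_span (by simp)))

end LinearSystem

/-! ### The rank of the coefficient matrix -/

section Rank

variable {K : Type*} [Field K]

theorem rank_coeffMatrix {b : Fin 6 → K} (h1 : b 1 - b 0 ≠ 0) (h3 : b 3 - b 5 ≠ 0)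
    (h5 : b 5 - b 0 ≠ 0) : (coeffMatrix b).rank = 5 := by
  let M := coeffMatrix b
  have hrow : ∀ c, M.mulVec c = 0 ↔
      (b 3 - b 0) * c 0 + (b 0 - b 2) * c 1 + (b 1 - b 0) * c 3 = 0 ∧
      (b 4 - b 0) * c 0 + (b 0 - b 2) * c 2 + (b 1 - b 0) * c 4 = 0 ∧
      (b 5 - b 0) * c 0 = 0 ∧ (b 5 - b 0) * c 5 = 0 ∧
      (b 5 - b 4) * c 1 + (b 3 - b 5) * c 2 + (b 5 - b 1) * c 5 = 0 ∧
      (b 5 - b 4) * c 3 + (b 3 - b 5) * c 4 + (b 5 - b 2) * c 5 = 0 := by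
    intro c
    rw [funext_iff]
    simp [M, coeffMatrix, Fin.forall_fin_succ, Matrix.mulVec, dotProduct, Fin.sum_univ_six]
  -- the kernel is spanned by the tensor product of `(b₁ - b₀, b₂ - b₀)` and `(b₃ - b₅, b₄ - b₅)`,
  -- in the coordinates `c₁, c₂, c₃, c₄`
  let c₀ : Fin 6 → K := ![0, (b 1 - b 0) * (b 3 - b 5), (b 1 - b 0) * (b 4 - b 5),
    (b 2 - b 0) * (b 3 - b 5), (b 2 - b 0) * (b 4 - b 5), 0]
  have hc₀ : c₀ ∈ LinearMap.ker M.mulVecLin := by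
    rw [LinearMap.mem_ker, Matrix.mulVecLin_apply, hrow]
    simp only [c₀]
    refine ⟨?_, ?_, ?_, ?_, ?_, ?_⟩ <;> simp <;> ring
  have hne : (⟨c₀, hc₀⟩ : LinearMap.ker M.mulVecLin) ≠ 0 := by
    intro h
    have := congrFun (congrArg Subtype.val h) 1
    exact mul_ne_zero h1 h3 this
  have hker : Module.finrank K (LinearMap.ker M.mulVecLin) = 1 := by
    rw [finrank_eq_one_iff_of_nonzero' _ hne]
    rintro ⟨c, hc⟩
    obtain ⟨e1, e2, e3, e4, e5, e6⟩ := (hrow c).1 (by simpa using hc)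
    have c0 : c 0 = 0 := (mul_eq_zero.1 e3).resolve_left h5
    have c5 : c 5 = 0 := (mul_eq_zero.1 e4).resolve_left h5
    rw [c0, mul_zero, zero_add] at e1 e2
    rw [c5, mul_zero, add_zero] at e5
    refine ⟨c 1 / ((b 1 - b 0) * (b 3 - b 5)), Subtype.ext ?_⟩
    funext i
    have e2' : (b 1 - b 0) * (b 3 - b 5) * c 4 = (b 2 - b 0) * (b 4 - b 5) * c 1 := by
      linear_combination (b 3 - b 5) * e2 - (b 0 - b 2) * e5
    fin_cases i <;> simp [c₀, c0, c5] <;> field_simp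
    · linear_combination -e5
    · linear_combination -e1
    · linear_combination -e2'
  have h := M.mulVecLin.finrank_range_add_finrank_ker
  rw [hker, Module.finrank_fin_fun] at h
  change Module.finrank K (LinearMap.range M.mulVecLin) = 5
  omega

open MvPolynomial in
theorem X_sub_X_ne_zero {σ : Type*} {i j : σ} (h : i ≠ j) :
    (X i - X j : MvPolynomial σ K) ≠ 0 := by
  rw [sub_ne_zero]
  exact fun h' => h (X_injective h')

end Rank

/-! ### Generic parameters -/

section GenericStatements

variable {K V : Type*} [Field K] [AddCommGroup V] [Module K V]

open MvPolynomial

theorem X_mul_X_sub_ne_zero {σ : Type*} {i j k l : σ} (hik : i ≠ k) (hil : i ≠ l) :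
    (X i * X j - X k * X l : MvPolynomial σ K) ≠ 0 := by
  classical
  intro h
  have := congrArg (eval (fun m => if m = i then (0 : K) else 1)) h
  simp [hik.symm, hil.symm] at this

theorem generic_finrank_Z (e : Module.Basis (Fin 7) K V) :
    Generic (fun x : Fin 2 × Fin 7 → K =>
      Module.finrank K (Z K e (∑ i, x (0, i) • e i) (∑ i, x (1, i) • e i)) = 1) := by
  refine ⟨(X (0, 0) * X (1, 1) - X (0, 1) * X (1, 0)) *
    (X (0, 3) * X (1, 4) - X (0, 4) * X (1, 3)), mul_ne_zero ?_ ?_, fun x hx => ?_⟩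
  · exact X_mul_X_sub_ne_zero (by decide) (by decide)
  · exact X_mul_X_sub_ne_zero (by decide) (by decide)
  · rw [eval_mul] at hx
    refine finrank_Z_eq_one e (x := fun i => x (0, i)) (y := fun i => x (1, i)) ?_ ?_
    · simpa using left_ne_zero_of_mul hx
    · simpa using right_ne_zero_of_mul hx

theorem generic_rank_and_finrank_Z (e : Module.Basis (Fin 7) K V) :
    Generic (fun b : Fin 6 → K => (coeffMatrix b).rank = 5 ∧
      Module.finrank K (Z K e (∑ i : Fin 6, e i.castSucc)
        (∑ i : Fin 6, b i • e i.castSucc)) = 1) := by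
  -- the first two factors are the minors that give `dim Z = 1`; the rank needs all but the second
  refine ⟨(X 1 - X 0) * (X 4 - X 3) * (X 3 - X 5) * (X 5 - X 0), ?_, fun b hb => ?_⟩
  · refine mul_ne_zero (mul_ne_zero (mul_ne_zero ?_ ?_) ?_) ?_ <;>
      exact X_sub_X_ne_zero (by decide)
  · simp only [eval_mul, eval_sub, eval_X, mul_ne_zero_iff] at hb
    obtain ⟨⟨⟨h1, h2⟩, h3⟩, h4⟩ := hb
    refine ⟨rank_coeffMatrix h1 h3 h4, ?_⟩
    have h := finrank_Z_eq_one e (x := Fin.snoc (α := fun _ => K) (fun _ => 1) 0)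
      (y := Fin.snoc (α := fun _ => K) b 0)
      (by
        change (1 : K) * b 1 - 1 * b 0 ≠ 0
        simpa using h1)
      (by
        change (1 : K) * b 4 - 1 * b 3 ≠ 0
        simpa using h2)
    have hs : ∀ y : Fin 6 → K, ∑ i : Fin 7, (Fin.snoc (α := fun _ => K) y 0 : Fin 7 → K) i • e i =
        ∑ i : Fin 6, y i • e i.castSucc := by
      intro y
      rw [Fin.sum_univ_castSucc]
      have : (Fin.snoc (α := fun _ => K) y 0 : Fin 7 → K) (Fin.last 6) = 0 := Fin.snoc_last _ _
      rw [this, zero_smul, add_zero]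
      simp only [Fin.snoc_castSucc]
    rw [hs, hs] at h
    have h1 : ∑ i : Fin 6, (1 : K) • e i.castSucc = ∑ i : Fin 6, e i.castSucc := by
      simp only [one_smul]
    rwa [h1] at h

end GenericStatements

/-! ### The cones over the Grassmannian and its secant varieties -/

section Cones

open MvPolynomial

variable {K : Type*} [Field K]

/-- The minor of a `3 × 7` matrix in the columns `S`. -/
def minor {R : Type*} [CommRing R] (x : Fin 3 → Fin 7 → R) (S : Set.powersetCard (Fin 7) 3) : R :=
  (Matrix.of fun i j => x i (Set.powersetCard.ofFinEmbEquiv.symm S j)).det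

theorem equivFun_ιMulti (v : Fin 3 → Fin 7 → K) (S : Set.powersetCard (Fin 7) 3) :
    (pluckerBasis K 3 7).equivFun (exteriorPower.ιMulti K 3 v) S = minor v S := by
  rw [Module.Basis.equivFun_apply, pluckerBasis, exteriorPower.basis_repr_apply,
    exteriorPower.ιMultiDual_apply_ιMulti]
  rfl

theorem map_minor {R R' : Type*} [CommRing R] [CommRing R'] (g : R →+* R')
    (x : Fin 3 → Fin 7 → R) (S : Set.powersetCard (Fin 7) 3) :
    g (minor x S) = minor (fun i j => g (x i j)) S := by
  rw [minor, RingHom.map_det]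
  rfl

variable (K) in
/-- The Plücker coordinates of a sum of `s` decomposable trivectors `x₁ ∧ x₂ ∧ x₃`, as polynomials
in the coordinates of the `3 s` vectors. -/
def secantPoly (s : ℕ) (S : Set.powersetCard (Fin 7) 3) :
    MvPolynomial (Fin s × Fin 3 × Fin 7) K :=
  ∑ r, minor (fun i m => X (r, i, m)) S

theorem eval_secantPoly {s : ℕ} (t : Fin s × Fin 3 × Fin 7 → K)
    (S : Set.powersetCard (Fin 7) 3) :
    eval t (secantPoly K s S) = ∑ r, minor (fun i m => t (r, i, m)) S := by
  rw [secantPoly, map_sum]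
  refine Finset.sum_congr rfl fun r _ => ?_
  rw [map_minor]
  simp

theorem eval_secantPoly_eq_equivFun {s : ℕ} (t : Fin s × Fin 3 × Fin 7 → K) :
    (fun S => eval t (secantPoly K s S)) = (pluckerBasis K 3 7).equivFun
      (∑ r, exteriorPower.ιMulti K 3 fun i m => t (r, i, m)) := by
  funext S
  rw [eval_secantPoly, map_sum, Finset.sum_apply]
  simp only [equivFun_ιMulti]

theorem ιMulti_ne_zero {v : Fin 3 → Fin 7 → K} (hv : LinearIndependent K v) :
    exteriorPower.ιMulti K 3 v ≠ 0 := by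
  have h := (exteriorPower.ιMulti_family_linearIndependent_field 3 hv).ne_zero
    (Set.powersetCard.ofFinEmbEquiv (RelEmbedding.refl _))
  simpa [exteriorPower.ιMulti_family] using h

/-- The cone over the Grassmannian consists of the decomposable trivectors, zero included. -/
theorem exists_mem_grassmannian_iff (x : ⋀[K]^3 (Fin 7 → K)) :
    (∃ p ∈ grassmannian K 3 7, x ∈ p.submodule) ↔ ∃ v, x = exteriorPower.ιMulti K 3 v := by
  have mem_mk : ∀ v : Fin 3 → Fin 7 → K, LinearIndependent K v →
      ∃ p ∈ grassmannian K 3 7, exteriorPower.ιMulti K 3 v ∈ p.submodule := by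
    intro v hv
    refine ⟨Projectivization.mk K _ (ιMulti_ne_zero hv), ⟨v, hv, ?_⟩, ?_⟩
    · exact Projectivization.submodule_mk _ _
    · rw [Projectivization.submodule_mk]
      exact Submodule.mem_span_singleton_self _
  constructor
  · rintro ⟨p, ⟨v, -, hp⟩, hx⟩
    rw [hp, Submodule.mem_span_singleton] at hx
    obtain ⟨c, rfl⟩ := hx
    refine ⟨Function.update v 0 (c • v 0), ?_⟩
    rw [AlternatingMap.map_update_smul, Function.update_eq_self]
  · rintro ⟨v, rfl⟩
    by_cases hv : LinearIndependent K v
    · exact mem_mk v hv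
    · rw [AlternatingMap.map_linearDependent _ _ hv]
      obtain ⟨p, hp, -⟩ := mem_mk _ ((Pi.basisFun K (Fin 7)).linearIndependent.comp _
        (Fin.castLE_injective (by norm_num : 3 ≤ 7)))
      exact ⟨p, hp, zero_mem _⟩

theorem affineCone_grassmannian :
    affineCone (pluckerBasis K 3 7) (grassmannian K 3 7) =
      Set.range fun t S => eval t (secantPoly K 1 S) := by
  ext y
  simp only [Set.mem_range, eval_secantPoly_eq_equivFun]
  constructor
  · rintro ⟨p, hp, x, hx, rfl⟩
    obtain ⟨v, rfl⟩ := (exists_mem_grassmannian_iff x).1 ⟨p, hp, hx⟩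
    exact ⟨fun t => v t.2.1 t.2.2, by simp⟩
  · rintro ⟨t, rfl⟩
    obtain ⟨p, hp, hx⟩ := (exists_mem_grassmannian_iff _).2 ⟨fun i m => t (0, i, m), rfl⟩
    exact ⟨p, hp, _, hx, by simp⟩

theorem affineCone_secant {s : ℕ} (hs : 0 < s) :
    affineCone (pluckerBasis K 3 7) {p | ∃ P : Fin s → ℙ K (⋀[K]^3 (Fin 7 → K)),
        (∀ i, P i ∈ grassmannian K 3 7) ∧ p.submodule ≤ ⨆ i, (P i).submodule} =
      Set.range fun t S => eval t (secantPoly K s S) := by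
  ext y
  simp only [Set.mem_range, eval_secantPoly_eq_equivFun]
  constructor
  · rintro ⟨p, ⟨P, hP, hp⟩, x, hx, rfl⟩
    obtain ⟨μ, hμ⟩ := (Submodule.mem_iSup_iff_exists_finsupp _ _).1 (hp hx)
    choose v hv using fun r => (exists_mem_grassmannian_iff (μ r)).1 ⟨P r, hP r, hμ.1 r⟩
    refine ⟨fun t => v t.1 t.2.1 t.2.2, ?_⟩
    rw [← hμ.2, Finsupp.sum_fintype _ _ (fun _ => rfl)]
    simp only [hv]
  · rintro ⟨t, rfl⟩
    choose P hP hx using fun r => (exists_mem_grassmannian_iff _).2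
      ⟨fun i m => t (r, i, m), rfl⟩
    set x := ∑ r, exteriorPower.ιMulti K 3 fun i m => t (r, i, m) with hxdef
    have hmem : x ∈ ⨆ i, (P i).submodule :=
      sum_mem fun r _ => Submodule.mem_iSup_of_mem r (hx r)
    by_cases h0 : x = 0
    · exact ⟨P ⟨0, hs⟩, ⟨P, hP, le_iSup (fun i => (P i).submodule) _⟩, x,
        by rw [h0]; exact zero_mem _, rfl⟩
    · refine ⟨Projectivization.mk K x h0, ⟨P, hP, ?_⟩, x, ?_, rfl⟩
      · rw [Projectivization.submodule_mk, Submodule.span_singleton_le_iff_mem]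
        exact hmem
      · rw [Projectivization.submodule_mk]
        exact Submodule.mem_span_singleton_self _

end Cones

/-! ### Terracini's lemma -/

section Tangent

open MvPolynomial

variable {K : Type*} [Field K]

/-- A Plücker coordinate as an alternating form. -/
def minorForm (S : Set.powersetCard (Fin 7) 3) : (Fin 7 → K) [⋀^Fin 3]→ₗ[K] K :=
  ((pluckerBasis K 3 7).coord S).compAlternatingMap (exteriorPower.ιMulti K 3)

theorem minorForm_apply (S : Set.powersetCard (Fin 7) 3) (v : Fin 3 → Fin 7 → K) :
    minorForm S v = minor v S := by
  rw [← equivFun_ιMulti]; rfl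

/-- The differential of the parametrization at `p`: replace a vector of `p r` by a tangent
direction, since the coordinates are affine in each variable. -/
theorem eval_pderiv_secantPoly [Infinite K] {s : ℕ} (p : Fin s → Fin 3 → Fin 7 → K) (r : Fin s)
    (i : Fin 3) (m : Fin 7) (S : Set.powersetCard (Fin 7) 3) :
    eval (fun t => p t.1 t.2.1 t.2.2) (pderiv (r, i, m) (secantPoly K s S)) =
      minorForm S (Function.update (p r) i (Pi.single m 1)) := by
  refine eval_pderiv_of_affine _ _ _ (∑ r, minor (p r) S) _ fun c => ?_
  set T : Fin s × Fin 3 × Fin 7 → K := (fun t => p t.1 t.2.1 t.2.2) + Pi.single (r, i, m) c with hT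
  rw [eval_secantPoly, ← Finset.add_sum_erase _ _ (Finset.mem_univ r),
    ← Finset.add_sum_erase _ (fun r => minor (p r) S) (Finset.mem_univ r)]
  have h1 : (fun (i' : Fin 3) (m' : Fin 7) => T (r, i', m')) =
      Function.update (p r) i (p r i + c • Pi.single m 1) := by
    funext i' m'
    by_cases hi : i' = i
    · subst hi
      by_cases hm : m' = m
      · subst hm; simp [hT]
      · simp [hT, hm]
    · simp [hT, hi]
  have h2 : ∀ r' ∈ Finset.univ.erase r,
      minor (fun (i' : Fin 3) (m' : Fin 7) => T (r', i', m')) S = minor (p r') S := by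
    intro r' hr'
    have : r' ≠ r := Finset.ne_of_mem_erase hr'
    congr 1
    funext i' m'
    simp [hT, this]
  rw [h1, Finset.sum_congr rfl h2, ← minorForm_apply, AlternatingMap.map_update_add,
    AlternatingMap.map_update_smul, Function.update_eq_self, minorForm_apply, smul_eq_mul]
  ring

/-- Terracini's lemma: a set `κ` of Plücker coordinates is algebraically independent on the cone
over the secant variety if no nonzero trivector form supported on `κ` vanishes on the tangent
spaces at the `s` points `p r`. -/
theorem algebraicIndependent_secantPoly [CharZero K] {s : ℕ} (p : Fin s → Fin 3 → Fin 7 → K)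
    (κ : Set (Set.powersetCard (Fin 7) 3))
    (h : ∀ t : (Fin 7 → K) [⋀^Fin 3]→ₗ[K] K,
      (∀ r i x, t (Function.update (p r) i x) = 0) →
      (∀ S ∉ κ, t (fun i => Pi.single (Set.powersetCard.ofFinEmbEquiv.symm S i) 1) = 0) → t = 0) :
    AlgebraicIndependent K (fun S : κ => secantPoly K s S) := by
  classical
  have : Fintype κ := Fintype.ofFinite κ
  refine algebraicIndependent_of_jacobian _ (fun t => p t.1 t.2.1 t.2.2) fun c hc => ?_
  have hc' : ∀ r i m,
      ∑ S : κ, minorForm S.1 (Function.update (p r) i (Pi.single m 1)) * c S = 0 := by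
    intro r i m
    simpa only [eval_pderiv_secantPoly] using hc (r, i, m)
  -- the form with coefficients `c`
  let t : (Fin 7 → K) [⋀^Fin 3]→ₗ[K] K :=
    (∑ S : κ, c S • (pluckerBasis K 3 7).coord S.1).compAlternatingMap (exteriorPower.ιMulti K 3)
  have ht : ∀ v, t v = ∑ S : κ, minorForm S.1 v * c S := by
    intro v
    simp [t, minorForm, LinearMap.sum_apply, mul_comm]
  have hbasis : ∀ S T : Set.powersetCard (Fin 7) 3,
      minorForm T (fun i => Pi.single (Set.powersetCard.ofFinEmbEquiv.symm S i) (1 : K)) =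
        if S = T then 1 else 0 := by
    intro S T
    have h1 : exteriorPower.ιMulti K 3 (fun i => Pi.single
        (Set.powersetCard.ofFinEmbEquiv.symm S i) (1 : K)) = pluckerBasis K 3 7 S := by
      rw [pluckerBasis, exteriorPower.basis_apply, exteriorPower.ιMulti_family]
      congr 1
      funext i
      simp
    rw [minorForm, LinearMap.compAlternatingMap_apply, h1]
    simp [Finsupp.single_apply]
  have ht0 : t = 0 := by
    refine h t (fun r i x => ?_) fun S hS => ?_
    · let ℓ : (Fin 7 → K) →ₗ[K] K := t.toMultilinearMap.toLinearMap (p r) i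
      suffices ℓ = 0 from LinearMap.congr_fun this x
      refine (Pi.basisFun K (Fin 7)).ext fun m => ?_
      change t (Function.update (p r) i (Pi.basisFun K (Fin 7) m)) = 0
      rw [ht, Pi.basisFun_apply]
      exact hc' r i m
    · rw [ht]
      refine Finset.sum_eq_zero fun T _ => ?_
      have : S ≠ T.1 := fun h => hS (h ▸ T.2)
      rw [hbasis, if_neg this, zero_mul]
  funext S
  have := ht (fun i => Pi.single (Set.powersetCard.ofFinEmbEquiv.symm S.1 i) 1)
  rw [ht0, Finset.sum_eq_single S (fun T _ hT => by
    rw [hbasis, if_neg (fun h => hT (Subtype.ext h.symm)), zero_mul]) (by simp)] at this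
  simpa [hbasis] using this.symm

end Tangent

/-! ### Lower bounds for the dimensions -/

section LowerBounds

variable {K : Type*} [Field K]

theorem map_three_swap_right {V : Type*} [AddCommGroup V] [Module K V] (t : V [⋀^Fin 3]→ₗ[K] K)
    {a b c : V} (h : t ![a, b, c] = 0) : t ![a, c, b] = 0 := by
  have h' := t.map_swap ![a, b, c] (i := 1) (j := 2) (by decide)
  rw [h, neg_zero] at h'
  rw [← h']
  congr 1
  ext1 i; fin_cases i <;> rfl

theorem map_three_swap_left {V : Type*} [AddCommGroup V] [Module K V] (t : V [⋀^Fin 3]→ₗ[K] K)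
    {a b c : V} (h : t ![a, b, c] = 0) : t ![b, a, c] = 0 := by
  have h' := t.map_swap ![a, b, c] (i := 0) (j := 1) (by decide)
  rw [h, neg_zero] at h'
  rw [← h']
  congr 1
  ext1 i; fin_cases i <;> rfl

/-- The conditions imposed by the tangent space at `a ∧ b ∧ c`. -/
theorem tangent_conditions {V : Type*} [AddCommGroup V] [Module K V] (t : V [⋀^Fin 3]→ₗ[K] K)
    {a b c : V} (h : ∀ i x, t (Function.update ![a, b, c] i x) = 0) :
    (∀ x, t ![a, b, x] = 0) ∧ (∀ x, t ![a, c, x] = 0) ∧ ∀ x, t ![b, c, x] = 0 := by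
  have h0 : ∀ x, t ![x, b, c] = 0 := fun x => by
    rw [← h 0 x]; congr 1; ext1 i; fin_cases i <;> rfl
  have h1 : ∀ x, t ![a, x, c] = 0 := fun x => by
    rw [← h 1 x]; congr 1; ext1 i; fin_cases i <;> rfl
  have h2 : ∀ x, t ![a, b, x] = 0 := fun x => by
    rw [← h 2 x]; congr 1; ext1 i; fin_cases i <;> rfl
  exact ⟨h2, fun x => map_three_swap_right t (h1 x),
    fun x => map_three_swap_right t (map_three_swap_left t (h0 x))⟩

theorem card_plucker : Fintype.card (Set.powersetCard (Fin 7) 3) = 35 := by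
  rw [← Nat.card_eq_fintype_card, Set.powersetCard.card]
  simp [Nat.choose]

/-- All Plücker coordinates but the one with indices `2, 5, 6` are algebraically independent on the
variety of secant planes, by Terracini's lemma at `e₀ ∧ e₁ ∧ e₂`, `e₃ ∧ e₄ ∧ e₅` and
`e₆ ∧ (e₀ + e₃) ∧ (e₁ + e₄)`. -/
theorem le_dim_secant [CharZero K] : ((34 : ℕ) : WithBot ℕ∞) ≤ ringKrullDim
    (MvPolynomial (Set.powersetCard (Fin 7) 3) K ⧸
      RingHom.ker (MvPolynomial.aeval (R := K) (secantPoly K 3))) := by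
  classical
  let S₀ : Set.powersetCard (Fin 7) 3 := ⟨{2, 5, 6}, rfl⟩
  have hS₀ : ∀ i, Set.powersetCard.ofFinEmbEquiv.symm S₀ i = ![2, 5, 6] i := by
    have : Set.powersetCard.ofFinEmbEquiv.symm S₀ =
        ⟨⟨![2, 5, 6], by decide⟩, by decide⟩ := by
      rw [Equiv.symm_apply_eq]
      exact Subtype.ext (by decide)
    intro i; rw [this]; rfl
  let e := Pi.basisFun K (Fin 7)
  have hind := algebraicIndependent_secantPoly (K := K) (s := 3)
    ![![e 0, e 1, e 2], ![e 3, e 4, e 5], ![e 6, e 0 + e 3, e 1 + e 4]] {S₀}ᶜ (by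
      intro t ht hS
      obtain ⟨a1, a2, a3⟩ := tangent_conditions t (ht 0)
      obtain ⟨b1, b2, b3⟩ := tangent_conditions t (ht 1)
      obtain ⟨c1, c2, c3⟩ := tangent_conditions t (ht 2)
      refine alternating_eq_zero_of_tangent e (v := e 0 + e 3) (w := e 1 + e 4) (α := 0) (β := 0)
        (by simp) (by simp) t a1 a2 a3 b1 b2 b3 c1 c2 ?_
      rw [← hS S₀ (by simp)]
      congr 1
      funext i
      rw [hS₀]
      fin_cases i <;> simp [e])
  have h := card_le_ringKrullDim_quotient_ker (secantPoly K 3)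
    (fun S : ({S₀}ᶜ : Set (Set.powersetCard (Fin 7) 3)) => S.1) hind
  rwa [Fintype.card_compl_set, card_plucker, Set.card_singleton] at h

theorem le_dim_grassmannian [CharZero K] : ((13 : ℕ) : WithBot ℕ∞) ≤ ringKrullDim
    (MvPolynomial (Set.powersetCard (Fin 7) 3) K ⧸
      RingHom.ker (MvPolynomial.aeval (R := K) (secantPoly K 1))) := by
  classical
  let e := Pi.basisFun K (Fin 7)
  -- the coordinates on the tangent space at `e₀ ∧ e₁ ∧ e₂`: at least two indices in `{0, 1, 2}`
  let κ : Set (Set.powersetCard (Fin 7) 3) := {S | Set.powersetCard.ofFinEmbEquiv.symm S 1 ≤ 2}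
  have hind := algebraicIndependent_secantPoly (K := K) (s := 1) ![![e 0, e 1, e 2]] κ (by
    intro t ht hS
    obtain ⟨a1, a2, a3⟩ := tangent_conditions t (ht 0)
    refine alternatingMap_ext_of_strictMono e fun f hf => ?_
    rw [AlternatingMap.zero_apply]
    by_cases h2 : f 1 ≤ 2
    · have hf' : (fun l => e (f l)) = ![e (f 0), e (f 1), e (f 2)] := by
        ext1 l; fin_cases l <;> rfl
      have cover : ∀ i j : Fin 7, i < j → j ≤ 2 →
          i = 0 ∧ j = 1 ∨ i = 0 ∧ j = 2 ∨ i = 1 ∧ j = 2 := by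
        decide
      rw [hf']
      obtain ⟨h0, h1⟩ | ⟨h0, h1⟩ | ⟨h0, h1⟩ := cover _ _ (hf (by decide : (0 : Fin 3) < 1)) h2 <;>
        rw [h0, h1]
      exacts [a1 _, a2 _, a3 _]
    · rw [← hS (Set.powersetCard.ofFinEmbEquiv (OrderEmbedding.ofStrictMono f hf)) ?_]
      · simp [e]
      · simpa [κ] using h2)
  have h := card_le_ringKrullDim_quotient_ker (secantPoly K 1) (fun S : κ => S.1) hind
  refine le_trans ?_ h
  let T := {p : Fin 7 × Fin 7 × Fin 7 // p.1 < p.2.1 ∧ p.2.1 < p.2.2 ∧ p.2.1 ≤ 2}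
  have hT : Fintype.card T = 13 := by decide
  have hmono : ∀ p : T, StrictMono ![p.1.1, p.1.2.1, p.1.2.2] := by
    intro p
    rw [Fin.strictMono_iff_lt_succ]
    intro i
    fin_cases i
    exacts [p.2.1, p.2.2.1]
  let F : T → κ := fun p =>
    ⟨Set.powersetCard.ofFinEmbEquiv (OrderEmbedding.ofStrictMono _ (hmono p)), by
      simpa [κ] using p.2.2.2⟩
  have hF : Function.Injective F := by
    intro p q hpq
    have h1 := Set.powersetCard.ofFinEmbEquiv.injective (Subtype.ext_iff.1 hpq)
    have h2 : ∀ i, ![p.1.1, p.1.2.1, p.1.2.2] i = ![q.1.1, q.1.2.1, q.1.2.2] i :=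
      fun i => DFunLike.congr_fun h1 i
    exact Subtype.ext (Prod.ext (h2 0) (Prod.ext (h2 1) (h2 2)))
  rw [← hT]
  exact_mod_cast Fintype.card_le_of_injective F hF

end LowerBounds

/-! ### An affine chart of the Grassmannian -/

section Chart

open MvPolynomial

variable {K : Type*} [Field K]

/-- The rows of the `3 × 7` matrix `(I | x)`. -/
def chartRows {R : Type*} [CommRing R] (x : Fin 3 → Fin 4 → R) : Fin 3 → Fin 7 → R :=
  fun i => Fin.append (m := 3) (n := 4) (fun j => if i = j then 1 else 0) (x i)

theorem chartRows_castAdd {R : Type*} [CommRing R] (x : Fin 3 → Fin 4 → R) (i j : Fin 3) :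
    chartRows x i (Fin.castAdd 4 j) = if i = j then 1 else 0 :=
  Fin.append_left _ _ j

theorem chartRows_natAdd {R : Type*} [CommRing R] (x : Fin 3 → Fin 4 → R) (i : Fin 3)
    (j : Fin 4) : chartRows x i (Fin.natAdd 3 j) = x i j :=
  Fin.append_right _ _ j

theorem eq_chartRows {R : Type*} [CommRing R] {A : Fin 3 → Fin 7 → R}
    (h : ∀ i j, A i (Fin.castAdd 4 j) = if i = j then 1 else 0) :
    A = chartRows fun i j => A i (Fin.natAdd 3 j) := by
  ext i m
  induction m using Fin.addCases (m := 3) (n := 4) with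
  | left j => rw [chartRows_castAdd, h]
  | right j => rw [chartRows_natAdd]

/-- The Plücker coordinates on the affine chart of the cone over the Grassmannian that consists of
the points `λ • x₁ ∧ x₂ ∧ x₃` with `xᵢ` the rows of a matrix `(I | x)`; the variable `none` stands
for `λ`. -/
def chartPoly (S : Set.powersetCard (Fin 7) 3) : MvPolynomial (Option (Fin 3 × Fin 4)) K :=
  X none * minor (chartRows fun i j => X (some (i, j))) S

theorem eval_chartPoly (t : Option (Fin 3 × Fin 4) → K) (S : Set.powersetCard (Fin 7) 3) :
    eval t (chartPoly S) = t none * minor (chartRows fun i j => t (some (i, j))) S := by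
  rw [chartPoly, map_mul, eval_X, map_minor]
  congr 2
  refine (eq_chartRows fun i j => ?_).trans ?_
  · rw [chartRows_castAdd]
    split_ifs <;> simp
  · simp only [chartRows_natAdd, eval_X]

theorem eval_aeval_eq {ι τ : Type*} (f : ι → MvPolynomial τ K) (F : MvPolynomial ι K)
    (t : τ → K) : eval t (aeval f F) = eval (fun i => eval t (f i)) F := by
  have : (eval t).comp (aeval (R := K) f : MvPolynomial ι K →+* MvPolynomial τ K) =
      eval (fun i => eval t (f i)) := by
    ext i <;> simp
  exact RingHom.congr_fun this F

/-- Two polynomial parametrizations satisfy the same relations if every point of the second one is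
a point of the first, and conversely up to the zeros of a nonzero polynomial. -/
theorem ker_aeval_eq_of_dense [Infinite K] {ι τ τ' : Type*} {f : ι → MvPolynomial τ K}
    {f' : ι → MvPolynomial τ' K} {δ : MvPolynomial τ K} (hδ : δ ≠ 0)
    (h : ∀ t', ∃ t, ∀ i, eval t (f i) = eval t' (f' i))
    (h' : ∀ t, eval t δ ≠ 0 → ∃ t', ∀ i, eval t (f i) = eval t' (f' i)) :
    RingHom.ker (aeval (R := K) f) = RingHom.ker (aeval (R := K) f') := by
  ext F
  simp only [RingHom.mem_ker]
  constructor
  · intro hF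
    refine MvPolynomial.funext fun t' => ?_
    obtain ⟨t, ht⟩ := h t'
    have := eval_aeval_eq f F t
    rw [hF, map_zero] at this
    rw [eval_aeval_eq, map_zero, this]
    simp only [ht]
  · intro hF
    refine (mul_eq_zero.1 (?_ : δ * aeval f F = 0)).resolve_left hδ
    refine MvPolynomial.funext fun t => ?_
    rw [map_mul, map_zero]
    by_cases hd : eval t δ = 0
    · rw [hd, zero_mul]
    · obtain ⟨t', ht'⟩ := h' t hd
      have := eval_aeval_eq f' F t'
      rw [hF, map_zero] at this
      rw [eval_aeval_eq]
      simp only [ht', ← this, mul_zero]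

theorem minor_mul (g : Matrix (Fin 3) (Fin 3) K) (x : Fin 3 → Fin 7 → K)
    (S : Set.powersetCard (Fin 7) 3) :
    minor (fun i m => (g * Matrix.of x) i m) S = g.det * minor x S := by
  unfold minor
  rw [← Matrix.det_mul]
  rfl

theorem dim_grassmannian_le [Infinite K] : ringKrullDim
    (MvPolynomial (Set.powersetCard (Fin 7) 3) K ⧸
      RingHom.ker (MvPolynomial.aeval (R := K) (secantPoly K 1))) ≤ ((13 : ℕ) : WithBot ℕ∞) := by
  let S₀ : Set.powersetCard (Fin 7) 3 :=
    Set.powersetCard.ofFinEmbEquiv (Fin.castLEOrderEmb (by norm_num))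
  have hS₀ : ∀ x : Fin 3 → Fin 7 → K,
      minor x S₀ = (Matrix.of fun i j => x i (Fin.castAdd 4 j)).det := by
    intro x
    simp only [minor, S₀, Equiv.symm_apply_apply]
    rfl
  have heq : RingHom.ker (aeval (R := K) (secantPoly K 1)) =
      RingHom.ker (aeval (R := K) (chartPoly (K := K))) := by
    -- every matrix whose first `3 × 3` minor does not vanish has the form `g * (I | x)`
    refine ker_aeval_eq_of_dense (δ := secantPoly K 1 S₀) (fun h => ?_) (fun t' => ?_)
      (fun t ht => ?_)
    · have h1 : eval (fun t => chartRows (fun _ _ => (0 : K)) t.2.1 t.2.2)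
          (secantPoly K 1 S₀) = 0 := by rw [h, map_zero]
      rw [eval_secantPoly, Fin.sum_univ_one, hS₀] at h1
      have h2 : (Matrix.of fun i j : Fin 3 => chartRows (fun _ _ => (0 : K)) i
          (Fin.castAdd 4 j)) = 1 := by
        ext i j
        rw [Matrix.of_apply, chartRows_castAdd, Matrix.one_apply]
      exact one_ne_zero (Matrix.det_one.symm.trans ((congrArg Matrix.det h2).symm.trans h1))
    · refine ⟨fun t => (Matrix.diagonal ![t' none, 1, 1] *
        Matrix.of (chartRows fun i j => t' (some (i, j)))) t.2.1 t.2.2, fun S => ?_⟩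
      rw [eval_secantPoly, Fin.sum_univ_one, eval_chartPoly]
      refine (minor_mul _ _ S).trans ?_
      rw [Matrix.det_diagonal, Fin.prod_univ_three]
      simp
    · let V : Fin 3 → Fin 7 → K := fun i m => t (0, i, m)
      let g : Matrix (Fin 3) (Fin 3) K := Matrix.of fun i j => V i (Fin.castAdd 4 j)
      let A : Fin 3 → Fin 7 → K := fun i m => (g⁻¹ * Matrix.of V) i m
      have hg : IsUnit g.det := by
        rw [eval_secantPoly, Fin.sum_univ_one, hS₀] at ht
        exact isUnit_iff_ne_zero.2 ht
      refine ⟨fun o => o.elim g.det fun p => A p.1 (Fin.natAdd 3 p.2), fun S => ?_⟩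
      have h1 : A = chartRows fun i j => A i (Fin.natAdd 3 j) := eq_chartRows fun i j => by
        have := congrFun₂ (Matrix.nonsing_inv_mul g hg) i j
        rw [Matrix.one_apply] at this
        exact this
      have h2 : g * Matrix.of A = Matrix.of V := by
        change g * (g⁻¹ * Matrix.of V) = Matrix.of V
        rw [← Matrix.mul_assoc, Matrix.mul_nonsing_inv g hg, Matrix.one_mul]
      rw [eval_secantPoly, Fin.sum_univ_one, eval_chartPoly]
      change minor V S = g.det * minor (chartRows fun i j => A i (Fin.natAdd 3 j)) S
      rw [← h1, ← minor_mul, h2]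
      rfl
  rw [heq]
  have h := ringKrullDim_quotient_ker_le_card (chartPoly (K := K))
  simpa using h

end Chart

/-! ### The equation of the variety of secant planes -/

section Products

open ExteriorAlgebra

variable {R M : Type*} [CommRing R] [AddCommGroup M] [Module R M]

theorem ιMulti_two (v : Fin 2 → M) : ιMulti R 2 v = ι R (v 0) * ι R (v 1) := by
  simp [ιMulti_apply]
  rfl

theorem ιMulti_three (v : Fin 3 → M) : ιMulti R 3 v = ι R (v 0) * ι R (v 1) * ι R (v 2) := by
  rw [ιMulti_succ_apply, ιMulti_two, mul_assoc]; rfl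

theorem ιMulti_five (v : Fin 5 → M) :
    ιMulti R 5 v = ι R (v 0) * ι R (v 1) * ι R (v 2) * ι R (v 3) * ι R (v 4) := by
  rw [ιMulti_succ_apply, ιMulti_succ_apply, ιMulti_three]
  simp only [mul_assoc]
  rfl

end Products

section Determinant

open MvPolynomial ExteriorAlgebra

variable {K : Type*} [Field K]

variable (K) in
/-- The determinant of the bilinear form `(a, c) ↦ a ∧ x ∧ c` on bivectors, as a polynomial in the
Plücker coordinates of the trivector `x`. -/
def wedgeDet : MvPolynomial (Set.powersetCard (Fin 7) 3) K :=
  Matrix.det (Matrix.of fun S T : Set.powersetCard (Fin 7) 2 =>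
    ∑ U, C (topForm (Pi.basisFun K (Fin 7))
      ((pluckerBasis K 2 7 T : ExteriorAlgebra K (Fin 7 → K)) *
      pluckerBasis K 3 7 U * pluckerBasis K 2 7 S)) * X U)

theorem eval_wedgeDet (x : ⋀[K]^3 (Fin 7 → K)) :
    eval ((pluckerBasis K 3 7).equivFun x) (wedgeDet K) =
      Matrix.det (Matrix.of fun S T : Set.powersetCard (Fin 7) 2 =>
        topForm (Pi.basisFun K (Fin 7)) ((pluckerBasis K 2 7 T : ExteriorAlgebra K (Fin 7 → K)) *
          x * pluckerBasis K 2 7 S)) := by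
  rw [wedgeDet, RingHom.map_det]
  congr 1
  ext S T
  have hx : (x : ExteriorAlgebra K (Fin 7 → K)) =
      ∑ U, (pluckerBasis K 3 7).equivFun x U • (pluckerBasis K 3 7 U : ExteriorAlgebra K _) := by
    simpa only [Submodule.coe_sum, Submodule.coe_smul] using
      congrArg Subtype.val ((pluckerBasis K 3 7).sum_equivFun x).symm
  simp only [RingHom.mapMatrix_apply, Matrix.map_apply, Matrix.of_apply, map_sum, map_mul, eval_C,
    eval_X]
  conv_rhs => rw [hx]
  simp only [Finset.mul_sum, Finset.sum_mul, map_sum, mul_smul_comm, smul_mul_assoc, map_smul,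
    smul_eq_mul]
  exact Finset.sum_congr rfl fun U _ => mul_comm _ _

/-- The determinant vanishes at `x` if and only if the form `(a, c) ↦ a ∧ x ∧ c` is degenerate. -/
theorem eval_wedgeDet_eq_zero_iff (x : ⋀[K]^3 (Fin 7 → K)) :
    eval ((pluckerBasis K 3 7).equivFun x) (wedgeDet K) = 0 ↔
      ∃ a : ⋀[K]^2 (Fin 7 → K), a ≠ 0 ∧ ∀ S, topForm (Pi.basisFun K (Fin 7))
        ((a : ExteriorAlgebra K (Fin 7 → K)) * x * pluckerBasis K 2 7 S) = 0 := by
  have key : ∀ (a : ⋀[K]^2 (Fin 7 → K)) (S : Set.powersetCard (Fin 7) 2),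
      (Matrix.of fun S T : Set.powersetCard (Fin 7) 2 =>
        topForm (Pi.basisFun K (Fin 7)) ((pluckerBasis K 2 7 T : ExteriorAlgebra K (Fin 7 → K)) *
          x * pluckerBasis K 2 7 S)).mulVec ((pluckerBasis K 2 7).equivFun a) S =
      topForm (Pi.basisFun K (Fin 7))
        ((a : ExteriorAlgebra K (Fin 7 → K)) * x * pluckerBasis K 2 7 S) := by
    intro a S
    have ha : (a : ExteriorAlgebra K (Fin 7 → K)) =
        ∑ T, (pluckerBasis K 2 7).equivFun a T • (pluckerBasis K 2 7 T : ExteriorAlgebra K _) := by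
      simpa only [Submodule.coe_sum, Submodule.coe_smul] using
        congrArg Subtype.val ((pluckerBasis K 2 7).sum_equivFun a).symm
    conv_rhs => rw [ha]
    simp only [Matrix.mulVec, dotProduct, Matrix.of_apply, Finset.sum_mul, map_sum, smul_mul_assoc,
      map_smul, smul_eq_mul]
    exact Finset.sum_congr rfl fun U _ => mul_comm _ _
  rw [eval_wedgeDet, ← Matrix.exists_mulVec_eq_zero_iff]
  constructor
  · rintro ⟨c, hc, h⟩
    refine ⟨(pluckerBasis K 2 7).equivFun.symm c, (LinearEquiv.map_ne_zero_iff _).2 hc, fun S => ?_⟩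
    rw [← key, LinearEquiv.apply_symm_apply, h, Pi.zero_apply]
  · rintro ⟨a, ha, h⟩
    exact ⟨(pluckerBasis K 2 7).equivFun a, (LinearEquiv.map_ne_zero_iff _).2 ha,
      funext fun S => by rw [key, h]; rfl⟩

theorem exists_basis_extend {V : Type*} [AddCommGroup V] [Module K V] [FiniteDimensional K V]
    {n m : ℕ} {v : Fin n → V} (hv : LinearIndependent K v) (hV : Module.finrank K V = n + m) :
    ∃ b : Module.Basis (Fin (n + m)) K V, ∀ i, b (Fin.castAdd m i) = v i := by
  let b := Module.Basis.sumExtend hv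
  have hfin : Finite (Fin n ⊕ Module.Basis.sumExtendIndex hv) := Module.Finite.finite_basis b
  have : Finite (Module.Basis.sumExtendIndex hv) := Finite.of_injective _
    (Sum.inr_injective (α := Fin n))
  have hcard : Nat.card (Module.Basis.sumExtendIndex hv) = m := by
    have h := Module.finrank_eq_nat_card_basis b
    rw [hV, Nat.card_sum, Nat.card_fin] at h
    omega
  refine ⟨b.reindex ((Equiv.sumCongr (Equiv.refl _) (Finite.equivFinOfCardEq hcard)).trans
    finSumFinEquiv), fun i => ?_⟩
  have h : b (Sum.inl i) = v i := by
    simp only [b, Module.Basis.sumExtend, Module.Basis.reindex_apply,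
      Module.Basis.extend_apply_self]
    let _ := Classical.decPred (· ∈ Set.range v)
    exact congrArg Subtype.val (Equiv.Set.sumDiffSubset_apply_inl
      (hv.linearIndepOn_id.subset_extend (Set.subset_univ _)) (Equiv.ofInjective v hv.injective i))
  simpa [Module.Basis.reindex_apply] using h

/-- Right multiplication by a fixed element on bivectors. -/
def mulBivector (z : ExteriorAlgebra K (Fin 7 → K)) :
    ⋀[K]^2 (Fin 7 → K) →ₗ[K] ExteriorAlgebra K (Fin 7 → K) :=
  LinearMap.mulRight K z ∘ₗ (⋀[K]^2 (Fin 7 → K)).subtype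

theorem mulBivector_apply (z : ExteriorAlgebra K (Fin 7 → K)) (a : ⋀[K]^2 (Fin 7 → K)) :
    mulBivector z a = a * z := rfl

/-- In a basis that starts with `v`, the bivectors that survive multiplication by `v₀ ∧ v₁ ∧ v₂` are
the six products of two of the last four basis vectors. -/
theorem finrank_range_mulBivector_le (v : Fin 3 → Fin 7 → K) :
    Module.finrank K (LinearMap.range (mulBivector (ιMulti K 3 v))) ≤ 6 := by
  by_cases hv : LinearIndependent K v
  · obtain ⟨b, hb⟩ : ∃ b : Module.Basis (Fin 7) K (Fin 7 → K), ∀ i, b (Fin.castAdd 4 i) = v i := by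
      exact exists_basis_extend (m := 4) hv (by simp)
    let T : Fin 6 → Fin 2 → Fin 7 := ![![3, 4], ![3, 5], ![3, 6], ![4, 5], ![4, 6], ![5, 6]]
    have hle : LinearMap.range (mulBivector (ιMulti K 3 v)) ≤ Submodule.span K
        (Set.range fun p : Fin 6 => ιMulti K 2 (b ∘ T p) * ιMulti K 3 v) := by
      rw [LinearMap.range_eq_map, ← (b.exteriorPower 2).span_eq, Submodule.map_span,
        Submodule.span_le]
      rintro _ ⟨_, ⟨S, rfl⟩, rfl⟩
      let f := Set.powersetCard.ofFinEmbEquiv.symm S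
      have hS : mulBivector (ιMulti K 3 v) (b.exteriorPower 2 S) =
          ιMulti K 2 (b ∘ f) * ιMulti K 3 v := by
        rw [exteriorPower.basis_apply]; rfl
      rw [hS]
      by_cases h0 : f 0 < 3
      · have : ιMulti K 2 (b ∘ f) * ιMulti K 3 v = 0 := by
          have h1 : ιMulti K 2 (b ∘ f) * ιMulti K 3 v =
              ιMulti K 5 ![b (f 0), b (f 1), v 0, v 1, v 2] := by
            rw [ιMulti_two, ιMulti_three, ιMulti_five]
            simp only [mul_assoc]
            rfl
          rw [h1]
          have h2 : b (f 0) = v ⟨f 0, h0⟩ := hb ⟨f 0, h0⟩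
          have h3 : ∀ j : Fin 3, v j = ![b (f 0), b (f 1), v 0, v 1, v 2] (Fin.natAdd 2 j) := by
            intro j; fin_cases j <;> rfl
          refine AlternatingMap.map_eq_zero_of_eq _ _ (i := 0) (j := Fin.natAdd 2 ⟨f 0, h0⟩) ?_ ?_
          · rw [← h3, ← h2]; rfl
          · intro h; have := congrArg Fin.val h; simp at this; omega
        rw [this]
        exact zero_mem _
      · refine Submodule.subset_span ?_
        have : ∀ i j : Fin 7, i < j → ¬ i < 3 → ∃ p, T p 0 = i ∧ T p 1 = j := by decide
        obtain ⟨p, hp0, hp1⟩ := this (f 0) (f 1) (f.strictMono (by decide)) h0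
        refine ⟨p, ?_⟩
        have : T p = f := by funext i; fin_cases i <;> assumption
        simp only [this]
    have := FiniteDimensional.span_of_finite K (Set.finite_range fun p : Fin 6 =>
      ιMulti K 2 (b ∘ T p) * ιMulti K 3 v)
    exact (Submodule.finrank_mono hle).trans ((finrank_range_le_card _).trans (by simp))
  · have : mulBivector (ιMulti K 3 v) = 0 := by
      rw [AlternatingMap.map_linearDependent _ _ hv]
      ext; simp [mulBivector]
    rw [this, LinearMap.range_zero, finrank_bot]
    exact Nat.zero_le _

/-- A sum of three decomposable trivectors is annihilated by a nonzero bivector: each summand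
contributes rank at most `6` to a map on the `21`-dimensional space of bivectors. -/
theorem exists_bivector_mul_eq_zero (v : Fin 3 → Fin 3 → Fin 7 → K) :
    ∃ a : ⋀[K]^2 (Fin 7 → K), a ≠ 0 ∧
      (a : ExteriorAlgebra K (Fin 7 → K)) * ∑ r, ιMulti K 3 (v r) = 0 := by
  by_contra! h
  let g := fun r => mulBivector (ιMulti K 3 (v r))
  have hinj : Function.Injective (mulBivector (∑ r, ιMulti K 3 (v r))) := by
    rw [injective_iff_map_eq_zero]
    intro a ha
    by_contra h0
    exact h a h0 ha
  have h1 := LinearMap.finrank_range_of_inj hinj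
  have h2 : Module.finrank K (⋀[K]^2 (Fin 7 → K)) = 21 := by
    rw [exteriorPower.finrank_eq]
    simp [Nat.choose]
  have h3 : LinearMap.range (mulBivector (∑ r, ιMulti K 3 (v r))) ≤
      LinearMap.range (g 0) ⊔ LinearMap.range (g 1) ⊔ LinearMap.range (g 2) := by
    rintro _ ⟨a, rfl⟩
    have : mulBivector (∑ r, ιMulti K 3 (v r)) a = g 0 a + g 1 a + g 2 a := by
      simp only [mulBivector_apply, g, Fin.sum_univ_three, mul_add]
    rw [this]
    exact Submodule.add_mem_sup (Submodule.add_mem_sup ⟨a, rfl⟩ ⟨a, rfl⟩) ⟨a, rfl⟩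
  have h4 := Submodule.finrank_mono h3
  have h5 := Submodule.finrank_add_le_finrank_add_finrank
    (LinearMap.range (g 0) ⊔ LinearMap.range (g 1)) (LinearMap.range (g 2))
  have h6 := Submodule.finrank_add_le_finrank_add_finrank
    (LinearMap.range (g 0)) (LinearMap.range (g 1))
  have h7 := fun r => finrank_range_mulBivector_le (v r)
  have := h7 0
  have := h7 1
  have := h7 2
  simp only [g] at *
  omega

end Determinant

/-! ### A trivector off the variety of secant planes -/

section Nondegenerate

open ExteriorAlgebra

variable {K V : Type*} [Field K] [CharZero K] [AddCommGroup V] [Module K V]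

variable (K) in
/-- The trivector `e₀₁₂ + e₀₃₄ + e₀₅₆ + e₁₃₅ + e₂₄₆`. -/
def genericTrivector (e : Fin 7 → V) : ⋀[K]^3 V :=
  exteriorPower.ιMulti K 3 (e ∘ ![0, 1, 2]) + exteriorPower.ιMulti K 3 (e ∘ ![0, 3, 4]) +
    exteriorPower.ιMulti K 3 (e ∘ ![0, 5, 6]) + exteriorPower.ιMulti K 3 (e ∘ ![1, 3, 5]) +
      exteriorPower.ιMulti K 3 (e ∘ ![2, 4, 6])

/-- The complements of the pairs of indices, each in the order in which it occurs in the products of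
the summands of `genericTrivector` with bivectors. -/
def complementTuples : List (Fin 5 → Fin 7) :=
  [![2, 4, 6, 0, 1], ![1, 3, 5, 0, 2], ![2, 4, 6, 0, 3], ![1, 3, 5, 0, 4], ![2, 4, 6, 0, 5],
    ![1, 3, 5, 0, 6], ![0, 5, 6, 1, 4], ![0, 3, 4, 1, 6], ![0, 5, 6, 2, 3], ![0, 3, 4, 2, 5],
    ![0, 1, 2, 3, 6], ![0, 1, 2, 4, 5], ![2, 4, 6, 1, 3], ![2, 4, 6, 1, 5], ![2, 4, 6, 3, 5],
    ![1, 3, 5, 2, 4], ![1, 3, 5, 2, 6], ![1, 3, 5, 4, 6], ![0, 1, 2, 3, 4], ![0, 1, 2, 5, 6],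
    ![0, 3, 4, 5, 6]]

/-- The bilinear form `(a, c) ↦ a ∧ φ ∧ c` on bivectors is nondegenerate for
`φ = e₀₁₂ + e₀₃₄ + e₀₅₆ + e₁₃₅ + e₂₄₆`.  The coordinates of `a` are, up to sign, the values
`a ∧ e_f` for the complementary `5`-tuples `f`. For `c = e_k ∧ e_l`, most of the five summands of
`φ` share an index with `c`; what remains is a system of `21` equations for the `21` coordinates with
at most two terms each. -/
theorem eq_zero_of_mul_genericTrivector (e : Module.Basis (Fin 7) K V) (a : ⋀[K]^2 V)
    (h : ∀ k l, topForm e ((a : ExteriorAlgebra K V) * genericTrivector K e *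
      ιMulti K 2 (e ∘ ![k, l])) = 0) : a = 0 := by
  obtain ⟨T, hT⟩ : ∃ T : (Fin 5 → Fin 7) → K,
      ∀ f, T f = wedgeForm e 5 (a : ExteriorAlgebra K V) (e ∘ f) := ⟨_, fun f => rfl⟩
  have nz : ∀ f : Fin 5 → Fin 7, ¬ Function.Injective f → T f = 0 := fun f hf => by
    rw [hT]
    exact AlternatingMap.map_eq_zero_of_not_injective _ _ fun h => hf h.of_comp
  have pz : ∀ g f : Fin 5 → Fin 7, T g = 0 → (∀ i, ∃ j, f i = g j) → T f = 0 := by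
    intro g f hg hfg
    rw [hT] at hg ⊢
    exact map_eq_zero_of_range _ e hfg hg
  have H : ∀ k l, T ![0, 1, 2, k, l] + T ![0, 3, 4, k, l] + T ![0, 5, 6, k, l] +
      T ![1, 3, 5, k, l] + T ![2, 4, 6, k, l] = 0 := by
    intro k l
    rw [← h k l]
    have mul : ∀ i j m : Fin 7, ιMulti K 5 (e ∘ ![i, j, m, k, l]) =
        ιMulti K 3 (e ∘ ![i, j, m]) * ιMulti K 2 (e ∘ ![k, l]) := by
      intro i j m
      rw [ιMulti_two, ιMulti_three, ιMulti_five]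
      simp only [mul_assoc]
      rfl
    simp only [hT, wedgeForm_apply, mul, genericTrivector, Submodule.coe_add,
      exteriorPower.ιMulti_apply_coe, mul_add, add_mul, map_add, mul_assoc]
  -- interchanging two pairs is an even permutation
  have swap : ∀ i j k l m : Fin 7, T ![i, l, m, j, k] = T ![i, j, k, l, m] := by
    intro i j k l m
    have h1 := (wedgeForm e 5 (a : ExteriorAlgebra K V)).map_perm (e ∘ ![i, j, k, l, m])
      (Equiv.swap 1 3 * Equiv.swap 2 4)
    have h2 : Equiv.Perm.sign (Equiv.swap 1 3 * Equiv.swap 2 4 : Equiv.Perm (Fin 5)) = 1 := by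
      decide
    rw [h2, one_smul] at h1
    rw [hT, hT, ← h1]
    congr 1
    funext i
    fin_cases i <;> rfl
  -- the equations with a single term, then those with a second term already known to vanish
  have h01 := H 0 1
  have h02 := H 0 2
  have h03 := H 0 3
  have h04 := H 0 4
  have h05 := H 0 5
  have h06 := H 0 6
  have h14 := H 1 4
  have h16 := H 1 6
  have h23 := H 2 3
  have h25 := H 2 5
  have h36 := H 3 6
  have h45 := H 4 5
  have h13 := H 1 3
  have h15 := H 1 5
  have h35 := H 3 5
  have h24 := H 2 4
  have h26 := H 2 6
  have h46 := H 4 6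
  -- three equations of the form `x + y = x + z = y + z = 0`
  have h12 := H 1 2
  have h34 := H 3 4
  have h56 := H 5 6
  simp (disch := decide) only [nz, add_zero, zero_add] at h01 h02 h03 h04 h05 h06 h14 h16 h23
  simp (disch := decide) only [nz, add_zero, zero_add] at h25 h36 h45 h13 h15 h35 h24 h26 h46
  simp (disch := decide) only [nz, add_zero, zero_add] at h12 h34 h56
  rw [pz _ ![0, 5, 6, 1, 3] h06 (by decide), zero_add] at h13
  rw [pz _ ![0, 3, 4, 1, 5] h04 (by decide), zero_add] at h15
  rw [pz _ ![0, 1, 2, 3, 5] h02 (by decide), zero_add] at h35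
  rw [pz _ ![0, 5, 6, 2, 4] h05 (by decide), zero_add] at h24
  rw [pz _ ![0, 3, 4, 2, 6] h03 (by decide), zero_add] at h26
  rw [pz _ ![0, 1, 2, 4, 6] h01 (by decide), zero_add] at h46
  rw [swap 0 1 2 3 4, swap 0 1 2 5 6] at h12
  rw [swap 0 3 4 5 6] at h34
  have two : (2 : K) ≠ 0 := two_ne_zero
  have k12 : T ![0, 1, 2, 3, 4] = 0 := by
    refine (mul_eq_zero.1 (?_ : 2 * T ![0, 1, 2, 3, 4] = 0)).resolve_left two
    linear_combination h12 + h34 - h56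
  rw [k12, zero_add] at h12 h34
  have all : ∀ g ∈ complementTuples, T g = 0 := by
    simp only [complementTuples, List.forall_mem_cons, List.not_mem_nil, false_imp_iff,
      implies_true, and_true]
    exact ⟨h01, h02, h03, h04, h05, h06, h14, h16, h23, h25, h36, h45, h13, h15, h35, h24, h26,
      h46, k12, h12, h34⟩
  refine (e.exteriorPower 2).ext_elem fun S => ?_
  obtain ⟨f, hf, u, hu, hz⟩ := exists_topForm_mul_eq (q := 5) rfl e S
  have hTf : T f = 0 := by
    have cover : ∀ k l : Fin 7, k < l →
        ∃ g ∈ complementTuples, ∀ i, i ≠ k → i ≠ l → ∃ j, i = g j := by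
      decide
    let s := Set.powersetCard.ofFinEmbEquiv.symm S
    have hs : ∀ i j, f i ≠ s j := fun i j hij => (hf (f i)).1 ⟨i, rfl⟩ (by
      rw [hij, ← Set.powersetCard.mem_range_ofFinEmbEquiv_symm_iff_mem]
      exact ⟨j, rfl⟩)
    obtain ⟨g, hg, hgs⟩ := cover (s 0) (s 1) (s.strictMono (by decide))
    exact pz g f (all g hg) fun i => hgs _ (hs i 0) (hs i 1)
  have := hz a
  rw [hT, wedgeForm_apply] at hTf
  rw [hTf] at this
  simpa [hu] using this.symm

end Nondegenerate

/-! ### The dimensions -/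

section Hypersurface

open MvPolynomial

variable {K : Type*} [Field K] [CharZero K]

/-- The determinant vanishes on the variety of secant planes. -/
theorem wedgeDet_mem_ker : wedgeDet K ∈ RingHom.ker (aeval (R := K) (secantPoly K 3)) := by
  rw [RingHom.mem_ker]
  refine MvPolynomial.funext fun t => ?_
  rw [eval_aeval_eq, map_zero, eval_secantPoly_eq_equivFun, eval_wedgeDet_eq_zero_iff]
  obtain ⟨a, ha, h⟩ := exists_bivector_mul_eq_zero fun r i m => t (r, i, m)
  refine ⟨a, ha, fun S => ?_⟩
  have h' : (a : ExteriorAlgebra K (Fin 7 → K)) *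
      ((∑ r, exteriorPower.ιMulti K 3 fun i m => t (r, i, m) : ⋀[K]^3 (Fin 7 → K)) :
        ExteriorAlgebra K (Fin 7 → K)) = 0 := by
    simpa only [Submodule.coe_sum, exteriorPower.ιMulti_apply_coe] using h
  rw [h', zero_mul, map_zero]

theorem eval_wedgeDet_genericTrivector_ne_zero :
    eval ((pluckerBasis K 3 7).equivFun (genericTrivector K (Pi.basisFun K (Fin 7))))
      (wedgeDet K) ≠ 0 := by
  rw [Ne, eval_wedgeDet_eq_zero_iff]
  rintro ⟨a, ha, h⟩
  refine ha (eq_zero_of_mul_genericTrivector (Pi.basisFun K (Fin 7)) a fun k l => ?_)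
  let φ : ⋀[K]^2 (Fin 7 → K) →ₗ[K] K := topForm (Pi.basisFun K (Fin 7)) ∘ₗ
    LinearMap.mulLeft K ((a : ExteriorAlgebra K (Fin 7 → K)) *
      genericTrivector K (Pi.basisFun K (Fin 7))) ∘ₗ (⋀[K]^2 (Fin 7 → K)).subtype
  have hφ : φ = 0 := (pluckerBasis K 2 7).ext fun S => h S
  exact LinearMap.congr_fun hφ (exteriorPower.ιMulti K 2 (Pi.basisFun K (Fin 7) ∘ ![k, l]))

theorem hasProjDim_grassmannian : HasProjDim (pluckerBasis K 3 7) (grassmannian K 3 7) 12 := by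
  rw [HasProjDim, homogeneousIdeal_eq_ker _ affineCone_grassmannian]
  exact le_antisymm dim_grassmannian_le le_dim_grassmannian

theorem hasProjDim_secantVariety : HasProjDim (pluckerBasis K 3 7)
    (secantVariety (pluckerBasis K 3 7) (grassmannian K 3 7) 3) 33 := by
  refine HasProjDim.zariskiClosure ?_
  rw [HasProjDim, homogeneousIdeal_eq_ker _ (affineCone_secant three_pos)]
  refine le_antisymm ?_ le_dim_secant
  have h0 : RingHom.ker (aeval (R := K) (secantPoly K 3)) ≠ ⊥ := fun h => by
    have h1 := wedgeDet_mem_ker (K := K)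
    rw [h, Ideal.mem_bot] at h1
    refine eval_wedgeDet_genericTrivector_ne_zero (K := K) ?_
    rw [h1, map_zero]
  have h := ringKrullDim_quotient_add_one_le h0
  rw [card_plucker] at h
  have h35 : ((35 : ℕ) : WithBot ℕ∞) = ((34 : ℕ) : WithBot ℕ∞) + 1 := by norm_num
  rw [h35] at h
  exact ENat.WithBot.add_le_add_one_right_iff.1 h

theorem secantVariety_ne_univ :
    secantVariety (pluckerBasis K 3 7) (grassmannian K 3 7) 3 ≠ Set.univ := by
  intro h
  set φ := genericTrivector K (Pi.basisFun K (Fin 7)) with hφ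
  have hne := eval_wedgeDet_genericTrivector_ne_zero (K := K)
  have h0 : φ ≠ 0 := by
    intro h0
    have : Nontrivial (⋀[K]^2 (Fin 7 → K)) := Module.nontrivial_of_finrank_pos (R := K) (by
      rw [exteriorPower.finrank_eq]
      simp [Nat.choose])
    obtain ⟨a, ha⟩ := exists_ne (0 : ⋀[K]^2 (Fin 7 → K))
    refine hne ((eval_wedgeDet_eq_zero_iff _).2 ⟨a, ha, fun S => ?_⟩)
    rw [← hφ, h0]
    simp
  have hmem : Projectivization.mk K φ h0 ∈
      secantVariety (pluckerBasis K 3 7) (grassmannian K 3 7) 3 := h ▸ Set.mem_univ _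
  have h1 := hmem φ (by
    rw [Projectivization.submodule_mk]
    exact Submodule.mem_span_singleton_self _)
  rw [homogeneousIdeal_eq_ker _ (affineCone_secant three_pos)] at h1
  exact hne (by simpa [aeval_eq_eval] using h1 _ wedgeDet_mem_ker)

omit [CharZero K] in
theorem finrank_trivectors : Module.finrank K (⋀[K]^3 (Fin 7 → K)) = 34 + 1 := by
  rw [exteriorPower.finrank_eq]
  simp [Nat.choose]

end Hypersurface

end SecantGrassmann

end

theorem mainTheorem6 (K : Type*) [Field K] [IsAlgClosed K] [CharZero K] :
    -- the ambient space is `ℙ^34`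
    Module.finrank K (⋀[K]^3 (Fin 7 → K)) = 34 + 1 ∧
    -- dimensions of the Grassmannian and of its variety of secant planes
    SecantGrassmann.HasProjDim (SecantGrassmann.pluckerBasis K 3 7)
      (SecantGrassmann.grassmannian K 3 7) 12 ∧
    SecantGrassmann.HasProjDim (SecantGrassmann.pluckerBasis K 3 7)
      (SecantGrassmann.secantVariety (SecantGrassmann.pluckerBasis K 3 7)
        (SecantGrassmann.grassmannian K 3 7) 3) 33 ∧
    -- the secant planes should fill `ℙ^34`, but they do not
    SecantGrassmann.expectedDim 34 12 3 = 34 ∧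
    SecantGrassmann.secantVariety (SecantGrassmann.pluckerBasis K 3 7)
      (SecantGrassmann.grassmannian K 3 7) 3 ≠ Set.univ ∧
    SecantGrassmann.IsDefective (SecantGrassmann.pluckerBasis K 3 7)
      (SecantGrassmann.grassmannian K 3 7) 3 ∧
    SecantGrassmann.HasDefect (SecantGrassmann.pluckerBasis K 3 7)
      (SecantGrassmann.grassmannian K 3 7) 3 1 ∧
    -- the space `Z` and the linear system, for every basis `e` of `K^7`
    ∀ e : Module.Basis (Fin 7) K (Fin 7 → K),
      -- `dim Z = 1` for generic vectors `v`, `w`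
      SecantGrassmann.Generic (fun x : Fin 2 × Fin 7 → K =>
        Module.finrank K (SecantGrassmann.Z K e (∑ i, x (0, i) • e i) (∑ i, x (1, i) • e i)) = 1) ∧
      -- for `v = e₀ + ⋯ + e₅` and `w = b₀ e₀ + ⋯ + b₅ e₅`, the system expresses that
      -- `v ∧ w ∧ Γ` lies in `Z`
      (∀ b c : Fin 6 → K,
        ExteriorAlgebra.ι K (∑ i : Fin 6, e i.castSucc) *
            ExteriorAlgebra.ι K (∑ i : Fin 6, b i • e i.castSucc) *
              SecantGrassmann.bivector K e c ∈
          SecantGrassmann.Z K e (∑ i : Fin 6, e i.castSucc) (∑ i : Fin 6, b i • e i.castSucc) ↔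
        (SecantGrassmann.coeffMatrix b).mulVec c = 0) ∧
      -- for generic `b` the matrix has rank 5 and `dim Z = 1`
      SecantGrassmann.Generic (fun b : Fin 6 → K =>
        (SecantGrassmann.coeffMatrix b).rank = 5 ∧
        Module.finrank K (SecantGrassmann.Z K e (∑ i : Fin 6, e i.castSucc)
          (∑ i : Fin 6, b i • e i.castSucc)) = 1) := by
  have hX := SecantGrassmann.hasProjDim_grassmannian (K := K)
  have hS := SecantGrassmann.hasProjDim_secantVariety (K := K)
  have hM := SecantGrassmann.finrank_trivectors (K := K)
  have hd : SecantGrassmann.expectedDim (Module.finrank K (⋀[K]^3 (Fin 7 → K)) - 1) 12 3 = 34 := by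
    rw [hM]; rfl
  refine ⟨hM, hX, hS, rfl, SecantGrassmann.secantVariety_ne_univ, ⟨12, 33, hX, hS, ?_⟩,
    ⟨12, 33, hX, hS, ?_⟩, fun e => ⟨SecantGrassmann.generic_finrank_Z e,
      SecantGrassmann.mem_Z_iff_mulVec_eq_zero e, SecantGrassmann.generic_rank_and_finrank_Z e⟩⟩
  · rw [hd]; norm_num
  · rw [hd]; norm_num
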